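/- Let $\{X_n, n\ge 1\}$ be a strictly stationary sequence of associated real random variables: for all finite index sets $\{i_1,\dots,i_m\}$ and all coordinatewise nondecreasing Borel functions $f,g:\mathbb R^m\to\mathbb R$, $\mathrm{Cov}(f(X_{i_1},\dots,X_{i_m}),g(X_{i_1},\dots,X_{i_m}))\ge 0$ whenever this covariance exists. Let $C_1>0$ be such that $|X_n|<C_1$ almost surely for all $n$, suppose $\sum_{j\ge1}\mathrm{Cov}(X_1,X_j)^{1/3}<\infty$, and let $F$ be the distribution of $X_1$. Let $\rho:\mathbb R^2\to\mathbb R$ be a Borel measurable symmetric kernel such that $\theta=\iint\rho(x,y)\,dF(x)\,dF(y)$ and $\rho_1(x)=\int\rho(x,y)\,dF(y)$, $x\in\mathbb R$, are well defined (the integrals converge absolutely). Put $h^{(2)}(x,y)=\rho(x,y)-\rho_1(x)-\rho_1(y)+\theta$ and $$U_n=\binom n2^{-1}\sum_{1\le i<j\le n}\rho(X_i,X_j).$$ Assume: 1. On $[-C_1,C_1]^4$ all first- and second-order partial derivatives of $(x,y,x',y')\mapsto h^{(2)}(x,y)\,h^{(2)}(x',y')$ exist (one-sided at the endpoints), and those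 of second order are bounded. 2. $0<\sigma_1^2:=\mathrm{Var}(\rho_1(X_1))<\infty$, and with $\sigma_{1j}^2:=\mathrm{Cov}(\rho_1(X_1),\rho_1(X_{1+j}))$ the series $\sum_{j\ge1}\sigma_{1j}^2$ converges absolutely. 3. $\rho$ is non-monotonic in $x$ (that is, it is neither true that $\rho(\cdot,y)$ is nondecreasing for every $y$, nor that $\rho(\cdot,y)$ is nonincreasing for every $y$), and $\sigma_U^2:=\sigma_1^2+2\sum_{j\ge1}\sigma_{1j}^2>0$. 4. There is a function $\tilde\rho_1:\mathbb R\to\mathbb R$ with $\rho_1\ll\tilde\rho_1$, i.e. $\tilde\rho_1+\rho_1$ and $\tilde\rho_1-\rho_1$ are both nondecreasing, such that $\sum_{j\ge1}\mathrm{Cov}(\tilde\rho_1(X_1),\tilde\rho_1(X_j))<\infty$. Then $$\frac{\sqrt n\,(U_n-\theta)}{2\sigma_U}\xrightarrow{\ \mathcal L\ }N(0,1)\qquad\text{as } n\to\infty .$$ -/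

import Mathlib

open MeasureTheory ProbabilityTheory Filter Topology

noncomputable section

namespace AssocUStat

/-- Strict stationarity of a sequence `X 0, X 1, …`: all finite-dimensional laws are invariant
under shifts of the index. -/
def IsStrictlyStationary {Ω : Type*} [MeasurableSpace Ω] (X : ℕ → Ω → ℝ) (P : Measure Ω) : Prop :=
  ∀ m k : ℕ, P.map (fun ω (i : Fin m) => X (i + k) ω) = P.map (fun ω (i : Fin m) => X i ω)

/-- A family of random variables is associated if for every finite subfamily and all
coordinatewise nondecreasing (Borel) functions `f`, `g` of it, the covariance of `f` and `g` is
nonnegative whenever it exists. -/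
def IsAssociated {Ω ι : Type*} [MeasurableSpace Ω] (X : ι → Ω → ℝ) (P : Measure Ω) : Prop :=
  ∀ (s : Finset ι) (f g : (s → ℝ) → ℝ),
    Monotone f → Monotone g → Measurable f → Measurable g →
    Integrable (fun ω => f (fun i => X i ω)) P →
    Integrable (fun ω => g (fun i => X i ω)) P →
    Integrable (fun ω => f (fun i => X i ω) * g (fun i => X i ω)) P →
    0 ≤ cov[fun ω => f (fun i => X i ω), fun ω => g (fun i => X i ω); P]

/-- `f ≪ g` in Newman's sense: `g + f` and `g - f` are both nondecreasing. -/
def NewmanDominated (f g : ℝ → ℝ) : Prop :=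
  Monotone (fun x => g x + f x) ∧ Monotone (fun x => g x - f x)

/-- The partial derivative of `g` at `z` in the `i`-th coordinate, the coordinate moving in `I`
(so it is one-sided where `z i` is an endpoint of an interval `I`). -/
def partialWithin {m : ℕ} (I : Set ℝ) (i : Fin m) (g : (Fin m → ℝ) → ℝ) (z : Fin m → ℝ) : ℝ :=
  derivWithin (fun t => g (Function.update z i t)) I (z i)

/-- On the cube `I ^ m` all partial derivatives of `g` of first and second order exist, and
those of second order are bounded. -/
def HasBoundedSecondPartials {m : ℕ} (I : Set ℝ) (g : (Fin m → ℝ) → ℝ) : Prop :=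
  (∀ i : Fin m, ∀ z : Fin m → ℝ, (∀ k, z k ∈ I) →
    DifferentiableWithinAt ℝ (fun t => g (Function.update z i t)) I (z i)) ∧
  (∀ i j : Fin m, ∀ z : Fin m → ℝ, (∀ k, z k ∈ I) →
    DifferentiableWithinAt ℝ (fun t => partialWithin I i g (Function.update z j t)) I (z j)) ∧
  ∃ M : ℝ, ∀ i j : Fin m, ∀ z : Fin m → ℝ, (∀ k, z k ∈ I) →
    |partialWithin I j (partialWithin I i g) z| ≤ M

/-- `θ = ∫∫ ρ(x, y) dF(x) dF(y)`; here `F` is the law itself. -/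
def theta (ρ : ℝ → ℝ → ℝ) (F : Measure ℝ) : ℝ := ∫ p, ρ p.1 p.2 ∂(F.prod F)

/-- `ρ₁(x) = ∫ ρ(x, y) dF(y)`. -/
def rhoOne (ρ : ℝ → ℝ → ℝ) (F : Measure ℝ) (x : ℝ) : ℝ := ∫ y, ρ x y ∂F

/-- The second-order component of the Hoeffding decomposition,
`h⁽²⁾(x, y) = ρ(x, y) - ρ₁(x) - ρ₁(y) + θ`. -/
def hTwo (ρ : ℝ → ℝ → ℝ) (F : Measure ℝ) (x y : ℝ) : ℝ :=
  ρ x y - rhoOne ρ F x - rhoOne ρ F y + theta ρ F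

/-- The U-statistic of degree two of the first `n` variables `X 0, …, X (n - 1)`. -/
def uStat {Ω : Type*} (ρ : ℝ → ℝ → ℝ) (X : ℕ → Ω → ℝ) (n : ℕ) (ω : Ω) : ℝ :=
  (n.choose 2 : ℝ)⁻¹ * ∑ j ∈ Finset.range n, ∑ i ∈ Finset.range j, ρ (X i ω) (X j ω)

/-- `σ_U² = Var f(X₁) + 2 ∑_{j ≥ 1} Cov(f(X₁), f(X_{1+j}))` (used with `f = ρ₁`); `X 0` is the
first variable of the sequence. -/
def sigmaSq {Ω : Type*} [MeasurableSpace Ω] (f : ℝ → ℝ) (X : ℕ → Ω → ℝ) (P : Measure Ω) : ℝ :=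
  Var[fun ω => f (X 0 ω); P] +
    2 * ∑' j : ℕ, cov[fun ω => f (X 0 ω), fun ω => f (X (j + 1) ω); P]

end AssocUStat

end

/-! The Hoeffding decomposition `uStat_sub_theta` splits `U_n - θ` into the average `(2/n) ∑
(ρ₁(X_i) - θ)` and a normalised sum of the degenerate kernel `h⁽²⁾` over pairs. The first part
carries the Gaussian limit, and the second is negligible at scale `√n`.

The linear part is handled with characteristic functions. If `f` and `g` have increments dominated
by those of `ft` and `gt`, association gives `|cov(f, g)| ≤ cov(ft, gt)` (`abs_cov_le`), hence
Newman's bound on the failure of a characteristic function to factorise. Cut the sum into blocks of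
fixed length `p`. Covariances with `ρt` in place of `ρ₁` are summable, so adjacent blocks need no
gaps: factorising costs at most `4t²` times a Cesàro mean of covariance tails, small for large `p`.
The block factors are treated by a second-order Taylor expansion, with `n → ∞` for `p` fixed
(`tendsto_expI_sum`).

For the degenerate part it is enough that the second moment of the pair sum is `o(n³)`. Expand it
into terms `E h(X_i, X_j) h(X_k, X_l)`. If one index is farther than `K` from the other three,
degeneracy in that variable and association bound the term by covariances at lags beyond `K`
(`abs_integral_le_of_degenerate`, `abs_integral_mul_le`); all these terms add up to `n³` times a
covariance tail. Otherwise the four indices pair up at distances at most `2K`, which leaves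
`O(K²n²)` terms of bounded size. Let `n → ∞` and then `K → ∞`.

The bounds on `h⁽²⁾` itself come from the product `h⁽²⁾(x, y) h⁽²⁾(x', y')` by freezing `(x', y')`
where `h⁽²⁾` is nonzero (`exists_bounds`). Clipping the arguments to the cube makes these bounds
global and changes nothing almost surely. -/

noncomputable section

namespace AssocUStat

/-! ### Domination of increments and covariance bounds under association. -/

/-- The sample path of `X` at `ω`. -/
abbrev path {Ω : Type*} (X : ℕ → Ω → ℝ) (ω : Ω) : ℕ → ℝ := fun i => X i ω

/-- Increments of `f` along the coordinatewise order are dominated by those of `ft`. -/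
def Dom {α : Type*} [Preorder α] (f ft : α → ℝ) : Prop :=
  ∀ x y, x ≤ y → |f y - f x| ≤ ft y - ft x

section Dom

variable {α : Type*} [Preorder α] {f ft g gt : α → ℝ}

lemma Dom.monotone_add (h : Dom f ft) : Monotone (fun x => ft x + f x) := fun x y hxy => by
  have := (abs_le.1 (h x y hxy)).1
  simp only; linarith

lemma Dom.monotone_sub (h : Dom f ft) : Monotone (fun x => ft x - f x) := fun x y hxy => by
  have := (abs_le.1 (h x y hxy)).2
  simp only; linarith

lemma Dom.comp_lipschitz {c : ℝ → ℝ} (hc : ∀ x y, |c x - c y| ≤ |x - y|) (h : Dom f ft) :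
    Dom (fun x => c (f x)) ft := fun x y hxy => (hc _ _).trans (h x y hxy)

lemma Dom.const_mul (h : Dom f ft) (s : ℝ) : Dom (fun x => s * f x) (fun x => |s| * ft x) :=
  fun x y hxy => by
    rw [← mul_sub, ← mul_sub, abs_mul]
    exact mul_le_mul_of_nonneg_left (h x y hxy) (abs_nonneg _)

lemma Dom.sub_const (h : Dom f ft) (s : ℝ) : Dom (fun x => f x - s) ft :=
  fun x y hxy => by simpa using h x y hxy

lemma Dom.sum {ι : Type*} {s : Finset ι} {f ft : ι → α → ℝ} (h : ∀ i ∈ s, Dom (f i) (ft i)) :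
    Dom (fun x => ∑ i ∈ s, f i x) (fun x => ∑ i ∈ s, ft i x) := fun x y hxy => by
  rw [← Finset.sum_sub_distrib, ← Finset.sum_sub_distrib]
  exact (Finset.abs_sum_le_sum_abs _ _).trans (Finset.sum_le_sum fun i hi => h i hi x y hxy)

lemma _root_.Monotone.dom_self (h : Monotone f) : Dom f f := fun _ _ hxy => by
  rw [abs_of_nonneg (sub_nonneg.2 (h hxy))]

lemma Dom.comp_monotone {β : Type*} [Preorder β] {u : β → α} (hu : Monotone u) (h : Dom f ft) :
    Dom (fun x => f (u x)) (fun x => ft (u x)) := fun _ _ hxy => h _ _ (hu hxy)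

lemma NewmanDominated.dom {f ft : ℝ → ℝ} (h : NewmanDominated f ft) : Dom f ft := fun x y hxy => by
  have h1 := h.1 hxy
  have h2 := h.2 hxy
  simp only at h1 h2
  rw [abs_le]
  constructor <;> linarith

end Dom

section Assoc

variable {Ω : Type*} [MeasurableSpace Ω] {P : Measure Ω} [IsProbabilityMeasure P]
  {X : ℕ → Ω → ℝ}

/-- Extension of a finite family by zero. -/
def extendZero (s : Finset ℕ) (v : s → ℝ) : ℕ → ℝ := fun i => if h : i ∈ s then v ⟨i, h⟩ else 0

lemma measurable_extendZero (s : Finset ℕ) : Measurable (extendZero s) := by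
  refine measurable_pi_lambda _ fun i => ?_
  by_cases h : i ∈ s
  · simpa [extendZero, h] using measurable_pi_apply _
  · simp [extendZero, h]

lemma monotone_extendZero (s : Finset ℕ) : Monotone (extendZero s) := fun v w hvw i => by
  by_cases h : i ∈ s
  · simpa [extendZero, h] using hvw _
  · simp [extendZero, h]

/-- Working with functions of the whole path that depend on finitely many coordinates lets blocks
with different index sets be added and compared without reindexing. -/
lemma IsAssociated.cov_nonneg (hassoc : IsAssociated X P) {f g : (ℕ → ℝ) → ℝ} (s : Finset ℕ)
    (hfs : DependsOn f (s : Set ℕ)) (hgs : DependsOn g (s : Set ℕ))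
    (hf : Monotone f) (hg : Monotone g) (hfm : Measurable f) (hgm : Measurable g)
    (hf2 : MemLp (fun ω => f (path X ω)) 2 P) (hg2 : MemLp (fun ω => g (path X ω)) 2 P) :
    0 ≤ cov[fun ω => f (path X ω), fun ω => g (path X ω); P] := by
  have key : ∀ {u : (ℕ → ℝ) → ℝ}, DependsOn u (s : Set ℕ) → ∀ ω,
      u (extendZero s fun i : s => X i ω) = u (path X ω) := by
    intro u hu ω
    refine hu fun i hi => ?_
    have hi' : i ∈ s := hi
    simp [extendZero, hi']
  have := hassoc s (fun v => f (extendZero s v)) (fun v => g (extendZero s v))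
    (hf.comp (monotone_extendZero s)) (hg.comp (monotone_extendZero s))
    (hfm.comp (measurable_extendZero s)) (hgm.comp (measurable_extendZero s))
  simp only [key hfs, key hgs] at this
  exact this (hf2.integrable (by norm_num)) (hg2.integrable (by norm_num)) (hf2.integrable_mul hg2)

/-- Both `ft ± f` and `gt ± g` are nondecreasing, so the four covariances between them are
nonnegative. Adding the two with equal signs cancels the cross terms and leaves `cov(ft, gt) +
cov(f, g) ≥ 0`; the two with opposite signs give `cov(ft, gt) - cov(f, g) ≥ 0`. -/
lemma IsAssociated.abs_cov_le (hassoc : IsAssociated X P) {f g ft gt : (ℕ → ℝ) → ℝ} (s : Finset ℕ)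
    (hfs : DependsOn f (s : Set ℕ)) (hgs : DependsOn g (s : Set ℕ))
    (hfts : DependsOn ft (s : Set ℕ)) (hgts : DependsOn gt (s : Set ℕ))
    (hf : Dom f ft) (hg : Dom g gt) (hfm : Measurable f) (hgm : Measurable g)
    (hftm : Measurable ft) (hgtm : Measurable gt)
    (hf2 : MemLp (fun ω => f (path X ω)) 2 P) (hg2 : MemLp (fun ω => g (path X ω)) 2 P)
    (hft2 : MemLp (fun ω => ft (path X ω)) 2 P) (hgt2 : MemLp (fun ω => gt (path X ω)) 2 P) :
    |cov[fun ω => f (path X ω), fun ω => g (path X ω); P]| ≤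
      cov[fun ω => ft (path X ω), fun ω => gt (path X ω); P] := by
  have hadd : ∀ {u v : (ℕ → ℝ) → ℝ}, DependsOn u (s : Set ℕ) → DependsOn v (s : Set ℕ) →
      DependsOn (fun x => u x + v x) (s : Set ℕ) := fun hu hv x y h => by
    simp only [hu h, hv h]
  have hsub : ∀ {u v : (ℕ → ℝ) → ℝ}, DependsOn u (s : Set ℕ) → DependsOn v (s : Set ℕ) →
      DependsOn (fun x => u x - v x) (s : Set ℕ) := fun hu hv x y h => by
    simp only [hu h, hv h]
  have h1 := hassoc.cov_nonneg s (hadd hfts hfs) (hadd hgts hgs) hf.monotone_add hg.monotone_add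
    (hftm.add hfm) (hgtm.add hgm) (hft2.add hf2) (hgt2.add hg2)
  have h2 := hassoc.cov_nonneg s (hsub hfts hfs) (hsub hgts hgs) hf.monotone_sub hg.monotone_sub
    (hftm.sub hfm) (hgtm.sub hgm) (hft2.sub hf2) (hgt2.sub hg2)
  have h3 := hassoc.cov_nonneg s (hadd hfts hfs) (hsub hgts hgs) hf.monotone_add hg.monotone_sub
    (hftm.add hfm) (hgtm.sub hgm) (hft2.add hf2) (hgt2.sub hg2)
  have h4 := hassoc.cov_nonneg s (hsub hfts hfs) (hadd hgts hgs) hf.monotone_sub hg.monotone_add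
    (hftm.sub hfm) (hgtm.add hgm) (hft2.sub hf2) (hgt2.add hg2)
  have ea : ∀ {U V W : Ω → ℝ}, MemLp U 2 P → MemLp V 2 P → MemLp W 2 P →
      cov[fun ω => U ω + V ω, W; P] = cov[U, W; P] + cov[V, W; P] := fun hU hV hW =>
    covariance_add_left hU hV hW
  have ear : ∀ {U V W : Ω → ℝ}, MemLp U 2 P → MemLp V 2 P → MemLp W 2 P →
      cov[W, fun ω => U ω + V ω; P] = cov[W, U; P] + cov[W, V; P] := fun hU hV hW =>
    covariance_add_right hW hU hV
  have hA : MemLp (fun ω => gt (path X ω) + g (path X ω)) 2 P := hgt2.add hg2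
  have hS : MemLp (fun ω => gt (path X ω) - g (path X ω)) 2 P := hgt2.sub hg2
  rw [ea hft2 hf2 hA, ear hgt2 hg2 hft2, ear hgt2 hg2 hf2] at h1
  rw [covariance_fun_sub_left hft2 hf2 hS, covariance_fun_sub_right hft2 hgt2 hg2,
    covariance_fun_sub_right hf2 hgt2 hg2] at h2
  rw [ea hft2 hf2 hS, covariance_fun_sub_right hft2 hgt2 hg2,
    covariance_fun_sub_right hf2 hgt2 hg2] at h3
  rw [covariance_fun_sub_left hft2 hf2 hA, ear hgt2 hg2 hft2, ear hgt2 hg2 hf2] at h4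
  rw [abs_le]
  constructor <;> linarith

end Assoc

/-! ### Consequences of stationarity. -/

section Stationary

variable {Ω : Type*} [MeasurableSpace Ω] {P : Measure Ω} {X : ℕ → Ω → ℝ}

lemma IsStrictlyStationary.identDistrib (hstat : IsStrictlyStationary X P)
    (hX : ∀ n, Measurable (X n)) (m k : ℕ) :
    IdentDistrib (fun ω (i : Fin m) => X (i + k) ω) (fun ω (i : Fin m) => X i ω) P P where
  aemeasurable_fst := (measurable_pi_lambda _ fun _ => hX _).aemeasurable
  aemeasurable_snd := (measurable_pi_lambda _ fun _ => hX _).aemeasurable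
  map_eq := hstat m k

lemma IsStrictlyStationary.identDistrib_single (hstat : IsStrictlyStationary X P)
    (hX : ∀ n, Measurable (X n)) (k : ℕ) : IdentDistrib (X k) (X 0) P P := by
  simpa [Function.comp_def] using
    (hstat.identDistrib hX 1 k).comp (measurable_pi_apply (0 : Fin 1))

lemma IsStrictlyStationary.cov_shift (hstat : IsStrictlyStationary X P)
    (hX : ∀ n, Measurable (X n)) {u : ℝ → ℝ} (hu : Measurable u) (k d : ℕ) :
    cov[fun ω => u (X k ω), fun ω => u (X (k + d) ω); P] =
      cov[fun ω => u (X 0 ω), fun ω => u (X d ω); P] := by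
  have e : ∀ n, ∫ ω, u (X n ω) ∂P = ∫ ω, u (X 0 ω) ∂P := fun n =>
    ((hstat.identDistrib_single hX n).comp hu).integral_eq
  unfold covariance
  rw [e k, e (k + d), e d, e 0]
  set c := ∫ ω, u (X 0 ω) ∂P
  have hm : Measurable fun v : Fin (d + 1) → ℝ => (u (v 0) - c) * (u (v (Fin.last d)) - c) := by
    fun_prop
  have := ((hstat.identDistrib hX (d + 1) k).comp hm).integral_eq
  simpa [Function.comp_def, add_comm] using this

/-- With truncated subtraction, `(i - j) + (j - i)` is the distance `Nat.dist i j`, so covariances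
form a Toeplitz array. -/
lemma IsStrictlyStationary.cov_eq (hstat : IsStrictlyStationary X P)
    (hX : ∀ n, Measurable (X n)) {u : ℝ → ℝ} (hu : Measurable u) (i j : ℕ) :
    cov[fun ω => u (X i ω), fun ω => u (X j ω); P] =
      cov[fun ω => u (X 0 ω), fun ω => u (X ((i - j) + (j - i)) ω); P] := by
  rcases le_total i j with h | h
  · obtain ⟨d, rfl⟩ := Nat.exists_eq_add_of_le h
    rw [hstat.cov_shift hX hu]; congr; simp
  · obtain ⟨d, rfl⟩ := Nat.exists_eq_add_of_le h
    rw [covariance_comm, hstat.cov_shift hX hu]; congr; simp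

end Stationary

/-! ### Characteristic functions and Newman's inequality. -/

section

variable {Ω : Type*} [MeasurableSpace Ω] {P : Measure Ω} [IsProbabilityMeasure P]
  {X : ℕ → Ω → ℝ}

/-- `E exp(iZ)`. -/
def expI (P : Measure Ω) (Z : Ω → ℝ) : ℂ := ∫ ω, Complex.exp (Z ω * Complex.I) ∂P

lemma integrable_cos {Z : Ω → ℝ} (hZ : Measurable Z) :
    Integrable (fun ω => Real.cos (Z ω)) P :=
  .of_bound (by fun_prop) 1 (.of_forall fun _ => Real.abs_cos_le_one _)

lemma integrable_sin {Z : Ω → ℝ} (hZ : Measurable Z) :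
    Integrable (fun ω => Real.sin (Z ω)) P :=
  .of_bound (by fun_prop) 1 (.of_forall fun _ => Real.abs_sin_le_one _)

lemma integrable_expI {Z : Ω → ℝ} (hZ : Measurable Z) :
    Integrable (fun ω => Complex.exp (Z ω * Complex.I)) P :=
  .of_bound (by fun_prop) 1 (.of_forall fun _ => (Complex.norm_exp_ofReal_mul_I _).le)

lemma expI_eq {Z : Ω → ℝ} (hZ : Measurable Z) :
    expI P Z = (∫ ω, Real.cos (Z ω) ∂P : ℝ) + (∫ ω, Real.sin (Z ω) ∂P : ℝ) * Complex.I := by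
  unfold expI
  simp_rw [Complex.exp_mul_I, ← Complex.ofReal_cos, ← Complex.ofReal_sin]
  rw [integral_add (integrable_cos hZ).ofReal ((integrable_sin hZ).ofReal.mul_const _),
    integral_mul_const, integral_complex_ofReal, integral_complex_ofReal]

lemma norm_expI_le (Z : Ω → ℝ) : ‖expI P Z‖ ≤ 1 := by
  refine (norm_integral_le_integral_norm _).trans ?_
  simp [Complex.norm_exp_ofReal_mul_I]

lemma norm_exp_mul_I_sub_le (x y : ℝ) :
    ‖Complex.exp (x * Complex.I) - Complex.exp (y * Complex.I)‖ ≤ |x - y| := by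
  have : Complex.exp (x * Complex.I) - Complex.exp (y * Complex.I) =
      Complex.exp (y * Complex.I) * (Complex.exp (Complex.I * (x - y : ℝ)) - 1) := by
    rw [mul_sub, ← Complex.exp_add]; congr 2 <;> push_cast <;> ring
  rw [this, norm_mul, Complex.norm_exp_ofReal_mul_I, one_mul]
  exact Real.norm_exp_I_mul_ofReal_sub_one_le

lemma norm_expI_sub_le {Y Z : Ω → ℝ} (hY : Measurable Y) (hZ : Measurable Z)
    (h : Integrable (fun ω => Y ω - Z ω) P) :
    ‖expI P Y - expI P Z‖ ≤ ∫ ω, |Y ω - Z ω| ∂P := by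
  unfold expI
  rw [← integral_sub (integrable_expI hY) (integrable_expI hZ)]
  refine (norm_integral_le_integral_norm _).trans ?_
  exact integral_mono ((integrable_expI hY).sub (integrable_expI hZ)).norm h.abs
    fun ω => norm_exp_mul_I_sub_le _ _

/-- **Newman's inequality** for characteristic functions of two dominated functions of an associated
sequence. -/
lemma IsAssociated.norm_expI_add_sub_le (hassoc : IsAssociated X P) (hX : ∀ n, Measurable (X n))
    {A B At Bt : (ℕ → ℝ) → ℝ} (s : Finset ℕ)
    (hAs : DependsOn A (s : Set ℕ)) (hBs : DependsOn B (s : Set ℕ))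
    (hAts : DependsOn At (s : Set ℕ)) (hBts : DependsOn Bt (s : Set ℕ))
    (hA : Dom A At) (hB : Dom B Bt) (hAm : Measurable A) (hBm : Measurable B)
    (hAtm : Measurable At) (hBtm : Measurable Bt)
    (hAt2 : MemLp (fun ω => At (path X ω)) 2 P) (hBt2 : MemLp (fun ω => Bt (path X ω)) 2 P) :
    ‖expI P (fun ω => A (path X ω) + B (path X ω)) -
        expI P (fun ω => A (path X ω)) * expI P (fun ω => B (path X ω))‖ ≤
      4 * cov[fun ω => At (path X ω), fun ω => Bt (path X ω); P] := by
  have hpath : Measurable (path X) := measurable_pi_lambda _ hX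
  have hA' : Measurable fun ω => A (path X ω) := hAm.comp hpath
  have hB' : Measurable fun ω => B (path X ω) := hBm.comp hpath
  have mc : ∀ {Z : Ω → ℝ}, Measurable Z → MemLp (fun ω => Real.cos (Z ω)) 2 P := fun hZ =>
    .of_bound (by fun_prop) 1 (.of_forall fun _ => Real.abs_cos_le_one _)
  have ms : ∀ {Z : Ω → ℝ}, Measurable Z → MemLp (fun ω => Real.sin (Z ω)) 2 P := fun hZ =>
    .of_bound (by fun_prop) 1 (.of_forall fun _ => Real.abs_sin_le_one _)
  have comp : ∀ {u : (ℕ → ℝ) → ℝ} (c : ℝ → ℝ), DependsOn u (s : Set ℕ) →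
      DependsOn (fun x => c (u x)) (s : Set ℕ) := fun c hu x y h => by simp only [hu h]
  -- Sine and cosine are 1-Lipschitz, so composing with them preserves domination. The real and
  -- imaginary parts of the defect each combine two such covariances, whence the factor 4.
  have key : ∀ {c d : ℝ → ℝ}, (∀ x y, |c x - c y| ≤ |x - y|) → (∀ x y, |d x - d y| ≤ |x - y|) →
      Measurable c → Measurable d → MemLp (fun ω => c (A (path X ω))) 2 P →
      MemLp (fun ω => d (B (path X ω))) 2 P →
      |(∫ ω, c (A (path X ω)) * d (B (path X ω)) ∂P) -
        (∫ ω, c (A (path X ω)) ∂P) * ∫ ω, d (B (path X ω)) ∂P| ≤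
      cov[fun ω => At (path X ω), fun ω => Bt (path X ω); P] := by
    intro c d hc hd hcm hdm h1 h2
    have := hassoc.abs_cov_le s (comp c hAs) (comp d hBs) hAts hBts (hA.comp_lipschitz hc)
      (hB.comp_lipschitz hd) (hcm.comp hAm) (hdm.comp hBm) hAtm hBtm h1 h2 hAt2 hBt2
    rwa [covariance_eq_sub h1 h2] at this
  have kcc := key Real.abs_cos_sub_cos_le Real.abs_cos_sub_cos_le (by fun_prop) (by fun_prop)
    (mc hA') (mc hB')
  have kss := key Real.abs_sin_sub_sin_le Real.abs_sin_sub_sin_le (by fun_prop) (by fun_prop)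
    (ms hA') (ms hB')
  have ksc := key Real.abs_sin_sub_sin_le Real.abs_cos_sub_cos_le (by fun_prop) (by fun_prop)
    (ms hA') (mc hB')
  have kcs := key Real.abs_cos_sub_cos_le Real.abs_sin_sub_sin_le (by fun_prop) (by fun_prop)
    (mc hA') (ms hB')
  have hAB : Measurable fun ω => A (path X ω) + B (path X ω) := hA'.add hB'
  rw [expI_eq hAB, expI_eq hA', expI_eq hB']
  simp_rw [Real.cos_add, Real.sin_add]
  have mi : ∀ {U V : Ω → ℝ}, MemLp U 2 P → MemLp V 2 P → Integrable (fun ω => U ω * V ω) P :=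
    fun hU hV => hU.integrable_mul hV
  rw [integral_sub (mi (mc hA') (mc hB')) (mi (ms hA') (ms hB')),
    integral_add (mi (ms hA') (mc hB')) (mi (mc hA') (ms hB'))]
  set cc := ∫ ω, Real.cos (A (path X ω)) * Real.cos (B (path X ω)) ∂P
  set ss := ∫ ω, Real.sin (A (path X ω)) * Real.sin (B (path X ω)) ∂P
  set sc := ∫ ω, Real.sin (A (path X ω)) * Real.cos (B (path X ω)) ∂P
  set cs := ∫ ω, Real.cos (A (path X ω)) * Real.sin (B (path X ω)) ∂P
  set ca := ∫ ω, Real.cos (A (path X ω)) ∂P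
  set sa := ∫ ω, Real.sin (A (path X ω)) ∂P
  set cb := ∫ ω, Real.cos (B (path X ω)) ∂P
  set sb := ∫ ω, Real.sin (B (path X ω)) ∂P
  refine (Complex.norm_le_abs_re_add_abs_im _).trans ?_
  have hre : ((((cc - ss : ℝ) : ℂ) + ((sc + cs : ℝ) : ℂ) * Complex.I) -
      ((ca : ℂ) + sa * Complex.I) * ((cb : ℂ) + sb * Complex.I)).re =
      (cc - ca * cb) - (ss - sa * sb) := by
    simp; ring
  have him : ((((cc - ss : ℝ) : ℂ) + ((sc + cs : ℝ) : ℂ) * Complex.I) -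
      ((ca : ℂ) + sa * Complex.I) * ((cb : ℂ) + sb * Complex.I)).im =
      (sc - sa * cb) + (cs - ca * sb) := by
    simp; ring
  rw [hre, him]
  have h1 := abs_sub (cc - ca * cb) (ss - sa * sb)
  have h2 := abs_add_le (sc - sa * cb) (cs - ca * sb)
  linarith

/-! ### Factorisation over consecutive blocks. -/

/-- Tail sums of the covariances `cov(u(X₀), u(X_d))`. -/
def covTail (P : Measure Ω) (X : ℕ → Ω → ℝ) (u : ℝ → ℝ) (k : ℕ) : ℝ :=
  ∑' d : ℕ, cov[fun ω => u (X 0 ω), fun ω => u (X (d + k) ω); P]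

lemma tendsto_covTail (Q : Measure Ω) (X : ℕ → Ω → ℝ) (u : ℝ → ℝ) :
    Tendsto (covTail Q X u) atTop (𝓝 0) :=
  tendsto_sum_nat_add fun d => cov[fun ω => u (X 0 ω), fun ω => u (X d ω); Q]

lemma IsAssociated.cov_single_nonneg (hassoc : IsAssociated X P)
    {u : ℝ → ℝ} (hu : Monotone u) (hu2 : ∀ i, MemLp (fun ω => u (X i ω)) 2 P) (i j : ℕ) :
    0 ≤ cov[fun ω => u (X i ω), fun ω => u (X j ω); P] :=
  hassoc.cov_nonneg (f := fun x => u (x i)) (g := fun x => u (x j)) {i, j}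
    (fun _ _ h => congrArg u (h i (by simp))) (fun _ _ h => congrArg u (h j (by simp)))
    (fun _ _ h => hu (h i)) (fun _ _ h => hu (h j)) (hu.measurable.comp (measurable_pi_apply i))
    (hu.measurable.comp (measurable_pi_apply j)) (hu2 i) (hu2 j)

/-- For fixed `j` the past indices sit at distinct lags, all at least `j + 1`, and the covariances
are nonnegative. The bound is therefore uniform in the length `N` of the past. -/
lemma IsAssociated.cov_blocks_le (hassoc : IsAssociated X P) (hX : ∀ n, Measurable (X n))
    (hstat : IsStrictlyStationary X P) {u : ℝ → ℝ} (hu : Monotone u)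
    (hu2 : ∀ i, MemLp (fun ω => u (X i ω)) 2 P)
    (hsum : Summable fun d => cov[fun ω => u (X 0 ω), fun ω => u (X d ω); P]) (N p : ℕ) :
    cov[fun ω => ∑ i ∈ Finset.range N, u (X i ω), fun ω => ∑ j ∈ Finset.range p, u (X (N + j) ω); P]
      ≤ ∑ j ∈ Finset.range p, covTail P X u (j + 1) := by
  rw [covariance_fun_sum_right' (fun j _ => hu2 _) (memLp_finsetSum _ fun i _ => hu2 i)]
  refine Finset.sum_le_sum fun j _ => ?_
  -- Reversing the past block turns the lag `N + j - i` into `e + (j + 1)` with `e` running upwards,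
  -- the form in which `covTail` is written.
  rw [covariance_fun_sum_left' (fun i _ => hu2 _) (hu2 _), ← Finset.sum_range_reflect]
  have hs := (summable_nat_add_iff (j + 1)).2 hsum
  refine le_trans (le_of_eq ?_) (hs.sum_le_tsum (Finset.range N)
    fun d _ => hassoc.cov_single_nonneg hu hu2 0 _)
  refine Finset.sum_congr rfl fun e he => ?_
  have he' := Finset.mem_range.1 he
  rw [hstat.cov_eq hX hu.measurable]
  congr 3
  ext ω
  congr 2
  omega

/-- Split off the last block, `m` times. Each split costs the same amount, because `cov_blocks_le`
does not see how long the past is, and earlier errors do not grow since `‖ψ‖ ≤ 1`. -/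
lemma IsAssociated.norm_expI_sub_pow_le (hassoc : IsAssociated X P) (hX : ∀ n, Measurable (X n))
    (hstat : IsStrictlyStationary X P) {f u : ℝ → ℝ} (hf : Measurable f) (hu : Monotone u)
    (hfu : Dom f u) (hu2 : ∀ i, MemLp (fun ω => u (X i ω)) 2 P)
    (hsum : Summable fun d => cov[fun ω => u (X 0 ω), fun ω => u (X d ω); P]) (s : ℝ) (p m : ℕ) :
    ‖expI P (fun ω => s * ∑ i ∈ Finset.range (m * p), f (X i ω)) -
        expI P (fun ω => s * ∑ i ∈ Finset.range p, f (X i ω)) ^ m‖ ≤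
      m * (4 * s ^ 2 * ∑ j ∈ Finset.range p, covTail P X u (j + 1)) := by
  induction m with
  | zero => simp [expI]
  | succ m ih =>
    set δ := ∑ j ∈ Finset.range p, covTail P X u (j + 1)
    set ψ := expI P (fun ω => s * ∑ i ∈ Finset.range p, f (X i ω)) with hψ
    have hshift : expI P (fun ω => s * ∑ j ∈ Finset.range p, f (X (m * p + j) ω)) = ψ := by
      have hm : Measurable fun v : Fin p → ℝ =>
          Complex.exp ((s * ∑ j, f (v j) : ℝ) * Complex.I) := by fun_prop
      have := ((hstat.identDistrib hX p (m * p)).comp hm).integral_eq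
      rw [hψ]
      unfold expI
      simp_rw [Finset.sum_range]
      simpa [Function.comp_def, add_comm] using this
    set A : (ℕ → ℝ) → ℝ := fun x => s * ∑ i ∈ Finset.range (m * p), f (x i)
    set B : (ℕ → ℝ) → ℝ := fun x => s * ∑ j ∈ Finset.range p, f (x (m * p + j))
    set At : (ℕ → ℝ) → ℝ := fun x => |s| * ∑ i ∈ Finset.range (m * p), u (x i)
    set Bt : (ℕ → ℝ) → ℝ := fun x => |s| * ∑ j ∈ Finset.range p, u (x (m * p + j))
    have d1 : ∀ (c : ℝ) (v : ℝ → ℝ), DependsOn (fun x : ℕ → ℝ =>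
        c * ∑ i ∈ Finset.range (m * p), v (x i)) (Finset.range (m * p + p) : Set ℕ) := by
      intro c v x y h
      simp only
      congr 1
      refine Finset.sum_congr rfl fun i hi => ?_
      rw [h i (by have := Finset.mem_range.1 hi; simp; omega)]
    have d2 : ∀ (c : ℝ) (v : ℝ → ℝ), DependsOn (fun x : ℕ → ℝ =>
        c * ∑ j ∈ Finset.range p, v (x (m * p + j))) (Finset.range (m * p + p) : Set ℕ) := by
      intro c v x y h
      simp only
      congr 1
      refine Finset.sum_congr rfl fun i hi => ?_
      rw [h (m * p + i) (by have := Finset.mem_range.1 hi; simp; omega)]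
    have hum := hu.measurable
    have hA : Dom A At := (Dom.sum fun i _ =>
      hfu.comp_monotone (u := fun x : ℕ → ℝ => x i) fun _ _ h => h i).const_mul s
    have hB : Dom B Bt := (Dom.sum fun j _ =>
      hfu.comp_monotone (u := fun x : ℕ → ℝ => x (m * p + j)) fun _ _ h => h _).const_mul s
    have hAt2 : MemLp (fun ω => At (path X ω)) 2 P :=
      (memLp_finsetSum _ fun i _ => hu2 i).const_mul |s|
    have hBt2 : MemLp (fun ω => Bt (path X ω)) 2 P :=
      (memLp_finsetSum _ fun j _ => hu2 (m * p + j)).const_mul |s|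
    have key := hassoc.norm_expI_add_sub_le hX (Finset.range (m * p + p)) (d1 s f) (d2 s f)
      (d1 |s| u) (d2 |s| u) hA hB (by fun_prop) (by fun_prop) (by fun_prop) (by fun_prop) hAt2 hBt2
    have hcov : cov[fun ω => At (path X ω), fun ω => Bt (path X ω); P] ≤ s ^ 2 * δ := by
      simp only [At, Bt]
      rw [covariance_const_mul_left, covariance_const_mul_right, ← mul_assoc, abs_mul_abs_self,
        ← sq]
      exact mul_le_mul_of_nonneg_left (hassoc.cov_blocks_le hX hstat hu hu2 hsum _ _) (sq_nonneg s)
    have hsplit : (fun ω => s * ∑ i ∈ Finset.range ((m + 1) * p), f (X i ω)) =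
        fun ω => A (path X ω) + B (path X ω) := by
      ext ω
      simp only [A, B, add_mul, one_mul, Finset.sum_range_add, mul_add]
    have hBψ : expI P (fun ω => B (path X ω)) = ψ := hshift
    rw [hBψ] at key
    rw [hsplit, pow_succ]
    have e : ∀ a b c d : ℂ, a - b * c = (a - d * c) + (d - b) * c := fun a b c d => by ring
    rw [e _ _ _ (expI P (fun ω => A (path X ω)))]
    refine (norm_add_le _ _).trans ?_
    rw [norm_mul]
    have h3 : ‖expI P (fun ω => A (path X ω)) - ψ ^ m‖ * ‖ψ‖ ≤ m * (4 * s ^ 2 * δ) :=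
      (mul_le_of_le_one_right (norm_nonneg _) (norm_expI_le _)).trans ih
    push_cast
    nlinarith

end

/-! ### Taylor expansion, block variance and Newman's central limit theorem. -/

lemma norm_pow_sub_pow_le_of_norm_le_one {a b : ℂ} (ha : ‖a‖ ≤ 1) (hb : ‖b‖ ≤ 1) (m : ℕ) :
    ‖a ^ m - b ^ m‖ ≤ m * ‖a - b‖ := by
  induction m with
  | zero => simp
  | succ m ih =>
    have e : a ^ (m + 1) - b ^ (m + 1) = a ^ m * (a - b) + (a ^ m - b ^ m) * b := by ring
    rw [e]
    refine (norm_add_le _ _).trans ?_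
    rw [norm_mul, norm_mul, norm_pow]
    have h1 : ‖a‖ ^ m * ‖a - b‖ ≤ ‖a - b‖ :=
      mul_le_of_le_one_left (norm_nonneg _) (pow_le_one₀ (norm_nonneg _) ha)
    have h2 : ‖a ^ m - b ^ m‖ * ‖b‖ ≤ ‖a ^ m - b ^ m‖ := mul_le_of_le_one_right (norm_nonneg _) hb
    push_cast
    linarith

lemma exp_sub_isLittleO (v : ℝ) :
    (fun s : ℝ => Complex.exp (-(v * s ^ 2 / 2 : ℝ)) - (1 - v * s ^ 2 / 2)) =o[𝓝 0]
      fun s : ℝ => s ^ 2 := by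
  have h1 : (fun s : ℝ => Complex.exp (-(v * s ^ 2 / 2 : ℝ)) - (1 - v * s ^ 2 / 2)) =O[𝓝 0]
      fun s : ℝ => s ^ 4 := by
    have hc : Tendsto (fun s : ℝ => |v * s ^ 2 / 2|) (𝓝 0) (𝓝 0) := by
      have : Continuous fun s : ℝ => |v * s ^ 2 / 2| := by fun_prop
      simpa using this.tendsto 0
    refine Asymptotics.IsBigO.of_bound (v ^ 2 / 4) ?_
    filter_upwards [hc.eventually_le_const one_pos] with s hs
    have hn : ‖(-(v * s ^ 2 / 2 : ℝ) : ℂ)‖ = |v * s ^ 2 / 2| := by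
      rw [norm_neg, Complex.norm_real, Real.norm_eq_abs]
    have := Complex.norm_exp_sub_one_sub_id_le (hn.trans_le hs)
    rw [hn, sq_abs] at this
    have e : Complex.exp (-(v * s ^ 2 / 2 : ℝ)) - (1 - v * s ^ 2 / 2) =
        Complex.exp (-(v * s ^ 2 / 2 : ℝ)) - 1 - (-(v * s ^ 2 / 2 : ℝ)) := by
      push_cast; ring
    rw [e]
    refine this.trans (le_of_eq ?_)
    rw [Real.norm_of_nonneg (by positivity)]
    ring
  refine h1.trans_isLittleO ?_
  exact Asymptotics.isLittleO_pow_pow (by norm_num)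

section

variable {Ω : Type*} [MeasurableSpace Ω] {P : Measure Ω} [IsProbabilityMeasure P]
  {X : ℕ → Ω → ℝ}

lemma expI_mul_isLittleO {Z : Ω → ℝ} (hZ : Measurable Z) (hZ2 : MemLp Z 2 P)
    (h0 : ∫ ω, Z ω ∂P = 0) :
    (fun s : ℝ => expI P (fun ω => s * Z ω) - Complex.exp (-(Var[Z; P] * s ^ 2 / 2 : ℝ))) =o[𝓝 0]
      fun s : ℝ => s ^ 2 := by
  have : IsProbabilityMeasure (P.map Z) := Measure.isProbabilityMeasure_map hZ.aemeasurable
  have hid : MemLp id 2 (P.map Z) := by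
    rw [memLp_map_measure_iff (by fun_prop) hZ.aemeasurable]
    exact hZ2
  have h1 := taylor_isLittleO_univ (x₀ := 0) (contDiff_charFun (n := 2) hid)
  simp_rw [taylorWithinEval_charFun_two_zero hZ.aemeasurable hid, sub_zero] at h1
  have hv : ∫ ω, (Z ^ 2) ω ∂P = Var[Z; P] := (variance_of_integral_eq_zero hZ.aemeasurable h0).symm
  rw [hv, h0] at h1
  refine (h1.sub (exp_sub_isLittleO Var[Z; P])).congr_left fun s => ?_
  have : expI P (fun ω => s * Z ω) = charFun (P.map Z) s := by
    rw [charFun_apply_real, integral_map hZ.aemeasurable (by fun_prop)]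
    simp [expI]
  rw [this]
  push_cast
  ring

/-- Replacing each factor by the Gaussian one with the same variance costs `o(t² / n)`, and there
are at most `n` factors. The Gaussian power is explicit, with `(n / p) / n → 1 / p`. -/
lemma tendsto_expI_pow_div {Z : Ω → ℝ} (hZ : Measurable Z) (hZ2 : MemLp Z 2 P)
    (h0 : ∫ ω, Z ω ∂P = 0) (p : ℕ) (t : ℝ) :
    Tendsto (fun n : ℕ => expI P (fun ω => t / √(n : ℝ) * Z ω) ^ (n / p)) atTop
      (𝓝 (Complex.exp (-((p : ℝ)⁻¹ * Var[Z; P] * t ^ 2 / 2 : ℝ)))) := by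
  set v := Var[Z; P]
  have hs : Tendsto (fun n : ℕ => t / √(n : ℝ)) atTop (𝓝 0) :=
    tendsto_const_nhds.div_atTop (Real.tendsto_sqrt_atTop.comp tendsto_natCast_atTop_atTop)
  have hv : 0 ≤ v := variance_nonneg _ _
  have hb : ∀ s : ℝ, ‖Complex.exp (-(v * s ^ 2 / 2 : ℝ))‖ ≤ 1 := fun s => by
    rw [← Complex.ofReal_neg, Complex.norm_exp_ofReal, Real.exp_le_one_iff]
    have : 0 ≤ v * s ^ 2 / 2 := by positivity
    linarith
  have hsq : ∀ n : ℕ, n ≠ 0 → (t / √(n : ℝ)) ^ 2 = t ^ 2 / n := fun n _ => by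
    rw [div_pow, Real.sq_sqrt n.cast_nonneg]
  have h1 : Tendsto (fun n : ℕ => expI P (fun ω => t / √(n : ℝ) * Z ω) ^ (n / p) -
      Complex.exp (-(v * (t / √(n : ℝ)) ^ 2 / 2 : ℝ)) ^ (n / p)) atTop (𝓝 0) := by
    have ho := (expI_mul_isLittleO hZ hZ2 h0).comp_tendsto hs
    rw [tendsto_zero_iff_norm_tendsto_zero, Metric.tendsto_atTop]
    intro ε hε
    have := ho.def (c := ε / (2 * (t ^ 2 + 1))) (by positivity)
    obtain ⟨N, hN⟩ := eventually_atTop.1 this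
    refine ⟨max N 1, fun n hn => ?_⟩
    have hn1 : n ≠ 0 := by have := le_of_max_le_right hn; omega
    have hn0 : (0 : ℝ) < n := by positivity
    have h2 := hN n (le_of_max_le_left hn)
    simp only [Function.comp_apply] at h2
    rw [Real.norm_of_nonneg (sq_nonneg _), hsq n hn1] at h2
    rw [dist_zero_right, norm_norm]
    refine lt_of_le_of_lt ((norm_pow_sub_pow_le_of_norm_le_one (norm_expI_le _) (hb _) _)) ?_
    have h3 : ((n / p : ℕ) : ℝ) ≤ n := by exact_mod_cast Nat.div_le_self n p
    rw [hsq n hn1]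
    calc ((n / p : ℕ) : ℝ) * _ ≤ n * (ε / (2 * (t ^ 2 + 1)) * (t ^ 2 / n)) :=
          mul_le_mul h3 h2 (norm_nonneg _) hn0.le
      _ = ε / 2 * (t ^ 2 / (t ^ 2 + 1)) := by field_simp
      _ ≤ ε / 2 * 1 := by
          gcongr
          rw [div_le_one (by positivity)]
          linarith
      _ < ε := by linarith
  have h2 : Tendsto (fun n : ℕ => Complex.exp (-(v * (t / √(n : ℝ)) ^ 2 / 2 : ℝ)) ^ (n / p)) atTop
      (𝓝 (Complex.exp (-((p : ℝ)⁻¹ * v * t ^ 2 / 2 : ℝ)))) := by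
    have hf := (tendsto_nat_floor_mul_div_atTop (R := ℝ) (a := (p : ℝ)⁻¹)
      (by positivity)).comp tendsto_natCast_atTop_atTop
    have hf' : Tendsto (fun n : ℕ => -(((n / p : ℕ) : ℝ) / n * v * t ^ 2 / 2)) atTop
        (𝓝 (-((p : ℝ)⁻¹ * v * t ^ 2 / 2))) := by
      refine ((((hf.congr fun n => ?_).mul_const v).mul_const (t ^ 2)).div_const 2).neg
      simp only [Function.comp_apply]
      rw [inv_mul_eq_div, Nat.floor_div_eq_div]
    have := (Complex.continuous_exp.comp Complex.continuous_ofReal).tendsto _ |>.comp hf'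
    simp only [Function.comp_def, Complex.ofReal_neg] at this
    refine this.congr' ?_
    filter_upwards [eventually_ne_atTop 0] with n hn
    rw [← Complex.exp_nat_mul, hsq n hn]
    congr 1
    push_cast
    ring
  simpa using h1.add h2

/-- Passing from `k` to `k + 1` summands raises the variance by `Var + 2 ∑_{d < k} cov`, which
converges to `sigmaSq`; the normalised variance is the Cesàro mean of these increments. -/
lemma IsStrictlyStationary.tendsto_variance_sum (hstat : IsStrictlyStationary X P)
    (hX : ∀ n, Measurable (X n)) {f : ℝ → ℝ} (hf : Measurable f)
    (hf2 : ∀ i, MemLp (fun ω => f (X i ω)) 2 P)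
    (hsum : Summable fun d => cov[fun ω => f (X 0 ω), fun ω => f (X (d + 1) ω); P]) :
    Tendsto (fun p : ℕ => (p : ℝ)⁻¹ * Var[fun ω => ∑ i ∈ Finset.range p, f (X i ω); P]) atTop
      (𝓝 (sigmaSq f X P)) := by
  have h : ∀ p : ℕ, Var[fun ω => ∑ i ∈ Finset.range p, f (X i ω); P] =
      ∑ k ∈ Finset.range p, (Var[fun ω => f (X 0 ω); P] +
        2 * ∑ d ∈ Finset.range k, cov[fun ω => f (X 0 ω), fun ω => f (X (d + 1) ω); P]) := by
    intro p
    induction p with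
    | zero =>
      simp only [Finset.range_zero, Finset.sum_empty]
      exact variance_zero P
    | succ p ih =>
      rw [Finset.sum_range_succ, ← ih]
      simp_rw [Finset.sum_range_succ]
      rw [variance_fun_add (memLp_finsetSum _ fun i _ => hf2 i) (hf2 p),
        covariance_fun_sum_left' (fun i _ => hf2 _) (hf2 _), ← Finset.sum_range_reflect]
      have e1 : Var[fun ω => f (X p ω); P] = Var[fun ω => f (X 0 ω); P] :=
        ((hstat.identDistrib_single hX p).comp hf).variance_eq
      have e2 : ∑ j ∈ Finset.range p, cov[fun ω => f (X (p - 1 - j) ω), fun ω => f (X p ω); P] =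
          ∑ d ∈ Finset.range p, cov[fun ω => f (X 0 ω), fun ω => f (X (d + 1) ω); P] := by
        refine Finset.sum_congr rfl fun d hd => ?_
        have hd' := Finset.mem_range.1 hd
        rw [hstat.cov_eq hX hf]
        congr 3
        ext ω
        congr 2
        omega
      rw [e1, e2]
      ring
  simp_rw [h]
  exact ((hsum.hasSum.tendsto_sum_nat.const_mul 2).const_add _).cesaro

/-- **Newman's central limit theorem** for a centred function `f` of a stationary associated
sequence, dominated by a monotone `u` with summable covariances. -/
lemma IsAssociated.tendsto_expI_sum (hassoc : IsAssociated X P) (hX : ∀ n, Measurable (X n))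
    (hstat : IsStrictlyStationary X P) {f u : ℝ → ℝ} (hf : Measurable f) (hu : Monotone u)
    (hfu : Dom f u) (hu2 : ∀ i, MemLp (fun ω => u (X i ω)) 2 P)
    (hsum : Summable fun d => cov[fun ω => u (X 0 ω), fun ω => u (X d ω); P])
    (hfsum : Summable fun d => cov[fun ω => f (X 0 ω), fun ω => f (X (d + 1) ω); P])
    {B : ℝ} (hB : ∀ i, ∀ᵐ ω ∂P, |f (X i ω)| ≤ B) (h0 : ∫ ω, f (X 0 ω) ∂P = 0) (t : ℝ) :
    Tendsto (fun n : ℕ => expI P (fun ω => t / √(n : ℝ) * ∑ i ∈ Finset.range n, f (X i ω))) atTop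
      (𝓝 (Complex.exp (-(sigmaSq f X P * t ^ 2 / 2 : ℝ)))) := by
  have hf2 : ∀ i, MemLp (fun ω => f (X i ω)) 2 P := fun i =>
    .of_bound (hf.comp (hX i)).aestronglyMeasurable B (hB i)
  set S : ℕ → Ω → ℝ := fun p ω => ∑ i ∈ Finset.range p, f (X i ω)
  have hS : ∀ p, Measurable (S p) := fun p => by fun_prop
  have hS2 : ∀ p, MemLp (S p) 2 P := fun p => memLp_finsetSum _ fun i _ => hf2 i
  have hS0 : ∀ p, ∫ ω, S p ω ∂P = 0 := fun p => by
    simp only [S]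
    rw [integral_finsetSum _ fun i _ => (hf2 i).integrable (by norm_num)]
    refine Finset.sum_eq_zero fun i _ => ?_
    rw [← h0]
    exact ((hstat.identDistrib_single hX i).comp hf).integral_eq
  set σ2 := sigmaSq f X P
  rw [Metric.tendsto_atTop]
  intro ε hε
  have hδ : Tendsto (fun p : ℕ => 4 * t ^ 2 * ((p : ℝ)⁻¹ *
      ∑ j ∈ Finset.range p, covTail P X u (j + 1))) atTop (𝓝 0) := by
    simpa using (((tendsto_add_atTop_iff_nat 1).2 (tendsto_covTail P X u)).cesaro).const_mul
      (4 * t ^ 2)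
  have hσ : Tendsto (fun p : ℕ => Complex.exp (-((p : ℝ)⁻¹ * Var[S p; P] * t ^ 2 / 2 : ℝ))) atTop
      (𝓝 (Complex.exp (-(σ2 * t ^ 2 / 2 : ℝ)))) := by
    have h1 := ((hstat.tendsto_variance_sum hX hf hf2 hfsum).mul_const (t ^ 2)).div_const 2
    have hc : Continuous fun x : ℝ => Complex.exp (-(x : ℂ)) := by fun_prop
    exact (hc.tendsto _).comp h1
  -- The block length is fixed first, so that both the dependence error and the distance of the
  -- block variance from its limit are small; only then does `n` grow.
  obtain ⟨p, hp0, hp1, hp2⟩ := ((eventually_gt_atTop 0).and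
    ((hδ.eventually_lt_const (by positivity : 0 < ε / 4)).and
      (Metric.tendsto_nhds.1 hσ (ε / 4) (by positivity)))).exists
  have hpos : (0 : ℝ) < p := by exact_mod_cast hp0
  have hψ := Metric.tendsto_nhds.1 (tendsto_expI_pow_div (hS p) (hS2 p) (hS0 p) p t) (ε / 4)
    (by positivity)
  -- The incomplete last block has fewer than `p` terms, each at most `B`.
  have hrem : Tendsto (fun n : ℕ => |t| * (p * B) / √(n : ℝ)) atTop (𝓝 0) :=
    tendsto_const_nhds.div_atTop (Real.tendsto_sqrt_atTop.comp tendsto_natCast_atTop_atTop)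
  obtain ⟨N, hN⟩ := eventually_atTop.1 ((eventually_gt_atTop 0).and (hψ.and
    (hrem.eventually_lt_const (by positivity : 0 < ε / 4))))
  refine ⟨N, fun n hn => ?_⟩
  obtain ⟨hn0, hψn, hremn⟩ := hN n hn
  have hnpos : (0 : ℝ) < n := by exact_mod_cast hn0
  have hB0 : 0 ≤ B := by
    obtain ⟨ω, hω⟩ := (hB 0).exists
    exact (abs_nonneg _).trans hω
  set m := n / p
  have hmn : m * p ≤ n := Nat.div_mul_le_self n p
  have hd1 : dist (expI P (fun ω => t / √(n : ℝ) * S n ω))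
      (expI P (fun ω => t / √(n : ℝ) * S (m * p) ω)) < ε / 4 := by
    refine lt_of_le_of_lt ?_ hremn
    rw [dist_eq_norm]
    have hdiff : ∀ᵐ ω ∂P, |t / √(n : ℝ) * S n ω - t / √(n : ℝ) * S (m * p) ω| ≤
        |t| * (p * B) / √(n : ℝ) := by
      filter_upwards [ae_all_iff.2 hB] with ω hω
      rw [← mul_sub, abs_mul, abs_div, abs_of_nonneg (Real.sqrt_nonneg _)]
      have : |S n ω - S (m * p) ω| ≤ p * B := by
        simp only [S]
        rw [← Finset.sum_Ico_eq_sub _ hmn]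
        refine (Finset.abs_sum_le_sum_abs _ _).trans ((Finset.sum_le_card_nsmul _ _ B
          fun i _ => hω i).trans ?_)
        rw [nsmul_eq_mul, Nat.card_Ico]
        refine mul_le_mul_of_nonneg_right ?_ hB0
        have : n - m * p ≤ p := by
          have h1 := Nat.div_add_mod n p
          have h2 := Nat.mod_lt n hp0
          rw [mul_comm] at h1
          simp only [m]
          omega
        exact_mod_cast this
      calc |t| / √(n : ℝ) * |S n ω - S (m * p) ω| ≤ |t| / √(n : ℝ) * (p * B) := by gcongr
        _ = _ := by ring
    have hi : Integrable (fun ω => t / √(n : ℝ) * S n ω - t / √(n : ℝ) * S (m * p) ω) P :=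
      (((hS2 n).const_mul _).sub ((hS2 _).const_mul _)).integrable (by norm_num)
    refine (norm_expI_sub_le (by fun_prop) (by fun_prop) hi).trans ?_
    refine (integral_mono_ae hi.abs (integrable_const _) hdiff).trans ?_
    simp
  have hd2 : dist (expI P (fun ω => t / √(n : ℝ) * S (m * p) ω))
      (expI P (fun ω => t / √(n : ℝ) * S p ω) ^ m) < ε / 4 := by
    refine lt_of_le_of_lt ?_ hp1
    rw [dist_eq_norm]
    refine (hassoc.norm_expI_sub_pow_le hX hstat hf hu hfu hu2 hsum _ p m).trans ?_
    set δ := ∑ j ∈ Finset.range p, covTail P X u (j + 1)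
    have hδ0 : 0 ≤ δ := Finset.sum_nonneg fun j _ => tsum_nonneg fun d =>
      hassoc.cov_single_nonneg hu hu2 _ _
    -- With `s² = t² / n`, the `m` splittings contribute a factor `m / n ≤ 1 / p`, which turns the
    -- sum of tails into a Cesàro mean.
    rw [div_pow, Real.sq_sqrt hnpos.le]
    have hm : (m : ℝ) / n ≤ (p : ℝ)⁻¹ := by
      rw [div_le_iff₀ hnpos, inv_mul_eq_div, le_div_iff₀ hpos]
      exact_mod_cast hmn
    calc (m : ℝ) * (4 * (t ^ 2 / n) * δ) = m / n * (4 * t ^ 2 * δ) := by ring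
      _ ≤ (p : ℝ)⁻¹ * (4 * t ^ 2 * δ) := by gcongr
      _ = _ := by ring
  have tri := dist_triangle4 (expI P (fun ω => t / √(n : ℝ) * S n ω))
    (expI P (fun ω => t / √(n : ℝ) * S (m * p) ω)) (expI P (fun ω => t / √(n : ℝ) * S p ω) ^ m)
    (Complex.exp (-((p : ℝ)⁻¹ * Var[S p; P] * t ^ 2 / 2 : ℝ)))
  have tri2 := dist_triangle (expI P (fun ω => t / √(n : ℝ) * S n ω))
    (Complex.exp (-((p : ℝ)⁻¹ * Var[S p; P] * t ^ 2 / 2 : ℝ)))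
    (Complex.exp (-(σ2 * t ^ 2 / 2 : ℝ)))
  linarith

end

/-- Telescoping over the grid `a, a + δ, …, a + N δ`: the increments of any `g` over the cells below
`w` add up to the increment from `a` to a grid point within `δ` of `w`. -/
lemma exists_grid_point {a δ w : ℝ} (hδ : 0 < δ) {N : ℕ} (haw : a ≤ w) (hw : w ≤ a + N * δ) :
    ∃ x : ℝ, |w - x| ≤ δ ∧ ∀ g : ℝ → ℝ,
      ∑ q ∈ Finset.range N, (g (a + (q + 1 : ℕ) * δ) - g (a + q * δ)) *
        (Set.Ici (a + (q + 1 : ℕ) * δ)).indicator 1 w = g x - g a := by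
  -- `m` counts the cells whose right endpoint is at most `w`; exactly these indicators are on.
  set m := ⌊(w - a) / δ⌋₊ with hm
  have h0 : 0 ≤ (w - a) / δ := div_nonneg (sub_nonneg.2 haw) hδ.le
  have hmN : m ≤ N := by
    have : (w - a) / δ ≤ N := by rw [div_le_iff₀ hδ]; linarith
    exact Nat.floor_le_of_le this
  have hind : ∀ q : ℕ, (Set.Ici (a + (q + 1 : ℕ) * δ)).indicator (1 : ℝ → ℝ) w =
      if q < m then 1 else 0 := by
    intro q
    have : a + (q + 1 : ℕ) * δ ≤ w ↔ q < m := by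
      rw [← Nat.succ_le_iff, hm, Nat.le_floor_iff h0, le_div_iff₀ hδ]
      constructor <;> intro h <;> linarith
    simp only [Set.indicator_apply, Set.mem_Ici, this, Pi.one_apply]
  refine ⟨a + m * δ, ?_, fun g => ?_⟩
  · have h1 := Nat.floor_le h0
    have h2 := Nat.lt_floor_add_one ((w - a) / δ)
    rw [← hm] at h1 h2
    rw [le_div_iff₀ hδ] at h1
    rw [div_lt_iff₀ hδ] at h2
    rw [abs_le]
    constructor <;> linarith
  · simp_rw [hind, mul_ite, mul_one, mul_zero]
    rw [← Finset.sum_filter]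
    have : (Finset.range N).filter (fun q => q < m) = Finset.range m := by
      ext q; simp; omega
    rw [this, Finset.sum_range_sub fun q : ℕ => g (a + q * δ)]
    simp

/-! ### Expectations of functions degenerate in one coordinate. -/

section

variable {Ω : Type*} [MeasurableSpace Ω] {P : Measure Ω} [IsProbabilityMeasure P]
  {X : ℕ → Ω → ℝ}

lemma abs_cov_le_of_abs_le {T G : Ω → ℝ} (hT : MemLp T 2 P) (hG : AEStronglyMeasurable G P) {δ : ℝ}
    (hGδ : ∀ᵐ ω ∂P, |G ω| ≤ δ) : |cov[T, G; P]| ≤ 2 * δ * ∫ ω, |T ω| ∂P := by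
  have hG2 : MemLp G 2 P := .of_bound hG δ hGδ
  have hTi := hT.integrable (q := 2) (by norm_num)
  have hGi := hG2.integrable (q := 2) (by norm_num)
  rw [covariance_eq_sub hT hG2]
  have h1 : |∫ ω, (T * G) ω ∂P| ≤ δ * ∫ ω, |T ω| ∂P := by
    refine (abs_integral_le_integral_abs).trans ?_
    rw [← integral_const_mul]
    refine integral_mono_ae (hT.integrable_mul hG2).abs (hTi.abs.const_mul δ) ?_
    filter_upwards [hGδ] with ω hω
    rw [Pi.mul_apply, abs_mul, mul_comm]
    exact mul_le_mul_of_nonneg_right hω (abs_nonneg _)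
  have h2 : |∫ ω, G ω ∂P| ≤ δ := by
    refine (abs_integral_le_integral_abs).trans ?_
    refine (integral_mono_ae hGi.abs (integrable_const δ) hGδ).trans ?_
    simp
  have h3 : |∫ ω, T ω ∂P| ≤ ∫ ω, |T ω| ∂P := abs_integral_le_integral_abs
  have h4 : |(∫ ω, T ω ∂P) * ∫ ω, G ω ∂P| ≤ (∫ ω, |T ω| ∂P) * δ := by
    rw [abs_mul]
    exact mul_le_mul h3 h2 (abs_nonneg _) ((abs_nonneg _).trans h3)
  refine (abs_sub _ _).trans ?_
  linarith

/-- A function of the path and of one further coordinate, which is degenerate in that coordinate and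
whose mixed increments are dominated by those of `(v, w) ↦ M * T v * w`, has expectation at most
`M * cov(T, X_j)`. -/
lemma IsAssociated.abs_integral_le_of_degenerate (hassoc : IsAssociated X P)
    (hX : ∀ n, Measurable (X n)) {Q : (ℕ → ℝ) → ℝ → ℝ} {T : (ℕ → ℝ) → ℝ} (s : Finset ℕ) (j : ℕ)
    (hQm : Measurable (Function.uncurry Q)) (hTm : Measurable T)
    (hQs : ∀ w, DependsOn (fun v => Q v w) (s : Set ℕ)) (hTs : DependsOn T (s : Set ℕ))
    {B L M C : ℝ} (hM : 0 ≤ M) (hC : 0 < C) (hL : 0 ≤ L) (hQB : ∀ v w, |Q v w| ≤ B)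
    (hQL : ∀ v w w', |Q v w - Q v w'| ≤ L * |w - w'|)
    (hQM : ∀ w w', w ≤ w' → Dom (fun v => Q v w' - Q v w) (fun v => M * (w' - w) * T v))
    (hdeg : ∀ v, ∫ ω, Q v (X j ω) ∂P = 0) (hXC : ∀ᵐ ω ∂P, |X j ω| ≤ C)
    (hT2 : MemLp (fun ω => T (path X ω)) 2 P) :
    |∫ ω, Q (path X ω) (X j ω) ∂P| ≤ M * cov[fun ω => T (path X ω), X j; P] := by
  have hpath : Measurable (path X) := measurable_pi_lambda _ hX
  have hXj2 : MemLp (X j) 2 P := .of_bound (hX j).aestronglyMeasurable C hXC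
  have hQv : ∀ w, Measurable fun v => Q v w := fun w =>
    hQm.comp (measurable_id.prodMk measurable_const)
  have hQw : ∀ v, Measurable (Q v) := fun v =>
    hQm.comp (measurable_const.prodMk measurable_id)
  have hQVW : Measurable fun ω => Q (path X ω) (X j ω) :=
    hQm.comp (hpath.prodMk (hX j))
  have hQint : Integrable (fun ω => Q (path X ω) (X j ω)) P :=
    .of_bound hQVW.aestronglyMeasurable B (.of_forall fun _ => hQB _ _)
  set c := cov[fun ω => T (path X ω), X j; P]
  set τ := ∫ ω, |T (path X ω)| ∂P
  -- Discretise the last coordinate on a grid of `N` cells. Each layer is an increment of `Q` in `w`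
  -- times a nondecreasing indicator of `X j`, so association applies layer by layer; the
  -- discretisation error is `O(1 / N)`.
  have main : ∀ N : ℕ, 0 < N → |∫ ω, Q (path X ω) (X j ω) ∂P| ≤
      (2 * L + M * (2 * τ)) * (2 * C / N) + M * c := by
    intro N hN
    have hNpos : (0 : ℝ) < N := by exact_mod_cast hN
    set δ := 2 * C / N with hδdef
    have hδ : 0 < δ := by positivity
    set x : ℕ → ℝ := fun q => -C + q * δ with hx
    set I : ℕ → ℝ → ℝ := fun q => (Set.Ici (x (q + 1))).indicator 1 with hI
    set D : ℕ → (ℕ → ℝ) → ℝ := fun q v => Q v (x (q + 1)) - Q v (x q) with hD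
    have hxs : ∀ q, x (q + 1) - x q = δ := fun q => by simp only [hx]; push_cast; ring
    have hgrid : ∀ w, |w| ≤ C → ∃ z : ℝ, |w - z| ≤ δ ∧ ∀ g : ℝ → ℝ,
        ∑ q ∈ Finset.range N, (g (x (q + 1)) - g (x q)) * I q w = g z - g (-C) := by
      intro w hw
      have hw' := abs_le.1 hw
      refine exists_grid_point hδ hw'.1 ?_
      have : (N : ℝ) * δ = 2 * C := by rw [hδdef]; field_simp
      linarith
    set R : (ℕ → ℝ) → ℝ → ℝ := fun v w => Q v (-C) + ∑ q ∈ Finset.range N, D q v * I q w with hR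
    have hRQ : ∀ v w, |w| ≤ C → |Q v w - R v w| ≤ L * δ := by
      intro v w hw
      obtain ⟨z, hz, hg⟩ := hgrid w hw
      have : R v w = Q v z := by
        simp only [hR, hD]
        rw [hg (Q v)]; ring
      rw [this]
      exact (hQL v w z).trans (mul_le_mul_of_nonneg_left hz hL)
    have hIm : ∀ q, Measurable (I q) := fun q => measurable_one.indicator measurableSet_Ici
    have hImono : ∀ q, Monotone (I q) := fun q a b hab => by
      simp only [hI, Set.indicator_apply, Set.mem_Ici, Pi.one_apply]
      split_ifs with h1 h2
      · exact le_rfl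
      · exact absurd (h1.trans hab) h2
      · exact zero_le_one
      · exact le_rfl
    have hI1 : ∀ q w, |I q w| ≤ 1 := fun q w => by
      simp only [hI, Set.indicator_apply, Pi.one_apply]
      split_ifs <;> simp
    have hDm : ∀ q, Measurable (D q) := fun q => (hQv _).sub (hQv _)
    have hDB : ∀ q v, |D q v| ≤ B + B := fun q v =>
      (abs_sub _ _).trans (add_le_add (hQB _ _) (hQB _ _))
    have hDV2 : ∀ q, MemLp (fun ω => D q (path X ω)) 2 P := fun q =>
      .of_bound ((hDm q).comp hpath).aestronglyMeasurable _ (.of_forall fun _ => hDB _ _)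
    have hIW2 : ∀ q, MemLp (fun ω => I q (X j ω)) 2 P := fun q =>
      .of_bound ((hIm q).comp (hX j)).aestronglyMeasurable _ (.of_forall fun _ => hI1 _ _)
    have hDV := fun q => (hDV2 q).integrable (q := 2) (by norm_num)
    have hIW := fun q => (hIW2 q).integrable (q := 2) (by norm_num)
    have hDI : ∀ q, Integrable (fun ω => D q (path X ω) * I q (X j ω)) P := fun q =>
      (hDV2 q).integrable_mul (hIW2 q)
    have hQ0 : Integrable (fun ω => Q (path X ω) (-C)) P :=
      .of_bound ((hQv _).comp hpath).aestronglyMeasurable B (.of_forall fun _ => hQB _ _)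
    have hRint : Integrable (fun ω => R (path X ω) (X j ω)) P :=
      hQ0.add (integrable_finsetSum _ fun q _ => hDI q)
    -- The mean of `R v (X j)` for frozen `v`, that is, the value under independence. By degeneracy
    -- the same mean for `Q` vanishes, so `τ₀` is only the discretisation error.
    set τ₀ : (ℕ → ℝ) → ℝ := fun v =>
      Q v (-C) + ∑ q ∈ Finset.range N, D q v * ∫ ω, I q (X j ω) ∂P with hτ₀
    have hτ₀int : Integrable (fun ω => τ₀ (path X ω)) P :=
      hQ0.add (integrable_finsetSum _ fun q _ => (hDV q).mul_const _)
    have hτ₀le : ∀ v, |τ₀ v| ≤ L * δ := by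
      intro v
      have hRv : Integrable (fun ω => R v (X j ω)) P :=
        (integrable_const _).add (integrable_finsetSum _ fun q _ => (hIW q).const_mul _)
      have hQv' : Integrable (fun ω => Q v (X j ω)) P :=
        .of_bound ((hQw v).comp (hX j)).aestronglyMeasurable B (.of_forall fun _ => hQB _ _)
      have e : τ₀ v = ∫ ω, R v (X j ω) ∂P := by
        simp only [hR]
        rw [integral_add (integrable_const _)
          (integrable_finsetSum _ fun q _ => (hIW q).const_mul _),
          integral_finsetSum _ fun q _ => (hIW q).const_mul _]
        simp [hτ₀, integral_const_mul]
      have e2 : τ₀ v = -∫ ω, (Q v (X j ω) - R v (X j ω)) ∂P := by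
        rw [integral_sub hQv' hRv, hdeg v, e]; ring
      rw [e2, abs_neg]
      refine abs_integral_le_integral_abs.trans ?_
      refine (integral_mono_ae (hQv'.sub hRv).abs (integrable_const (L * δ)) ?_).trans ?_
      · filter_upwards [hXC] with ω hω using hRQ v _ hω
      · simp
    -- All dependence between the path and `X j` is now in covariances of single layers.
    have hER : ∫ ω, R (path X ω) (X j ω) ∂P = ∫ ω, τ₀ (path X ω) ∂P +
        ∑ q ∈ Finset.range N, cov[fun ω => D q (path X ω), fun ω => I q (X j ω); P] := by
      simp only [hR, hτ₀]
      rw [integral_add hQ0 (integrable_finsetSum _ fun q _ => hDI q),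
        integral_finsetSum _ fun q _ => hDI q,
        integral_add hQ0 (integrable_finsetSum _ fun q _ => (hDV q).mul_const _),
        integral_finsetSum _ fun q _ => (hDV q).mul_const _, add_assoc,
        ← Finset.sum_add_distrib]
      congr 1
      refine Finset.sum_congr rfl fun q _ => ?_
      rw [covariance_eq_sub (hDV2 q) (hIW2 q), integral_mul_const]
      simp only [Pi.mul_apply]
      ring
    have hcovq : ∀ q, |cov[fun ω => D q (path X ω), fun ω => I q (X j ω); P]| ≤
        M * cov[fun ω => T (path X ω), fun ω => δ * I q (X j ω); P] := by
      intro q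
      have hle : x q ≤ x (q + 1) := by linarith [hxs q]
      have hDD : Dom (D q) (fun v => M * δ * T v) := by
        have := hQM _ _ hle
        rwa [hxs] at this
      have hsub : (s : Set ℕ) ⊆ ((insert j s : Finset ℕ) : Set ℕ) := by simp
      have := hassoc.abs_cov_le (f := D q) (ft := fun v => M * δ * T v)
        (g := fun v => I q (v j)) (gt := fun v => I q (v j)) (insert j s)
        (DependsOn.mono hsub fun a b h => by
          simp only [hD]
          rw [show Q a (x (q + 1)) = Q b (x (q + 1)) from hQs _ h,
            show Q a (x q) = Q b (x q) from hQs _ h])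
        (fun _ _ h => congrArg (I q) (h j (by simp)))
        (DependsOn.mono hsub fun a b h => by simp only [hTs h])
        (fun _ _ h => congrArg (I q) (h j (by simp))) hDD
        ((hImono q).dom_self.comp_monotone (u := fun v : ℕ → ℝ => v j) fun _ _ h => h j)
        (hDm q) ((hIm q).comp (measurable_pi_apply j)) (hTm.const_mul _)
        ((hIm q).comp (measurable_pi_apply j)) (hDV2 q) (hIW2 q) (hT2.const_mul _) (hIW2 q)
      refine this.trans (le_of_eq ?_)
      rw [covariance_const_mul_left, covariance_const_mul_right]
      ring
    -- The layers `δ * I q` add up to a staircase within `δ` of `X j + C`, so the summed covariance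
    -- recovers `cov(T, X j)` up to `2 * δ * τ`.
    have hcovsum : ∑ q ∈ Finset.range N, cov[fun ω => T (path X ω), fun ω => δ * I q (X j ω); P] ≤
        c + 2 * δ * τ := by
      rw [← covariance_fun_sum_right' (fun q _ => (hIW2 q).const_mul δ) hT2]
      have hS2 : MemLp (fun ω => ∑ q ∈ Finset.range N, δ * I q (X j ω)) 2 P :=
        memLp_finsetSum _ fun q _ => (hIW2 q).const_mul δ
      set S : Ω → ℝ := fun ω => ∑ q ∈ Finset.range N, δ * I q (X j ω)
      have hSW : ∀ᵐ ω ∂P, |S ω - (X j ω + C)| ≤ δ := by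
        filter_upwards [hXC] with ω hω
        obtain ⟨z, hz, hg⟩ := hgrid _ hω
        have := hg id
        simp only [id, hxs] at this
        simp only [S]
        rw [this, abs_sub_comm]
        convert hz using 2
        ring
      have hWC : MemLp (fun ω => X j ω + C) 2 P := hXj2.add (memLp_const C)
      have h1 := abs_cov_le_of_abs_le hT2 (hS2.sub hWC).aestronglyMeasurable hSW
      rw [covariance_sub_right hT2 hS2 hWC,
        covariance_add_const_right (hXj2.integrable (by norm_num))] at h1
      have := (abs_le.1 h1).2
      linarith
    have h1 : |∫ ω, Q (path X ω) (X j ω) ∂P - ∫ ω, R (path X ω) (X j ω) ∂P| ≤ L * δ := by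
      rw [← integral_sub hQint hRint]
      refine abs_integral_le_integral_abs.trans ?_
      refine (integral_mono_ae (hQint.sub hRint).abs (integrable_const (L * δ)) ?_).trans ?_
      · filter_upwards [hXC] with ω hω using hRQ _ _ hω
      · simp
    have h2 : |∫ ω, τ₀ (path X ω) ∂P| ≤ L * δ := by
      refine abs_integral_le_integral_abs.trans ?_
      refine (integral_mono hτ₀int.abs (integrable_const (L * δ)) fun ω => hτ₀le _).trans ?_
      simp
    have h3 : |∑ q ∈ Finset.range N, cov[fun ω => D q (path X ω), fun ω => I q (X j ω); P]| ≤
        M * (c + 2 * δ * τ) := by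
      refine (Finset.abs_sum_le_sum_abs _ _).trans ((Finset.sum_le_sum fun q _ => hcovq q).trans ?_)
      rw [← Finset.mul_sum]
      exact mul_le_mul_of_nonneg_left hcovsum hM
    rw [hER] at h1
    rw [abs_le] at h1 h2 h3 ⊢
    constructor <;> linarith
  have hlim : Tendsto (fun N : ℕ => (2 * L + M * (2 * τ)) * (2 * C / N) + M * c) atTop
      (𝓝 (M * c)) := by
    simpa using ((tendsto_const_div_atTop_nhds_zero_nat (2 * C)).const_mul
      (2 * L + M * (2 * τ))).add_const (M * c)
  exact ge_of_tendsto hlim ((eventually_gt_atTop 0).mono main)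

end

/-! ### Second moment of the degenerate pair sum. -/

/-- Row sums of a Toeplitz array are at most twice the sum of its generating sequence. -/
lemma sum_range_dist_le {φ : ℕ → ℝ} (h0 : ∀ d, 0 ≤ φ d) (hs : Summable φ) (n i : ℕ) :
    ∑ j ∈ Finset.range n, φ (Nat.dist i j) ≤ 2 * ∑' d, φ d := by
  have key : ∀ (t : Finset ℕ), Set.InjOn (fun j => Nat.dist i j) (t : Set ℕ) →
      ∑ j ∈ t, φ (Nat.dist i j) ≤ ∑' d, φ d := by
    intro t ht
    rw [← Finset.sum_image (f := φ) (g := fun j => Nat.dist i j) ht]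
    exact hs.sum_le_tsum _ fun d _ => h0 d
  rw [← Finset.sum_filter_add_sum_filter_not (Finset.range n) (fun j => j ≤ i), two_mul]
  refine add_le_add (key _ ?_) (key _ ?_)
  all_goals
    intro a ha b hb hab
    simp only [Finset.coe_filter, Set.mem_ofPred_eq, Nat.dist] at ha hb hab
    omega

/-- The counting behind the second moment: a pair term leaves two free indices besides the one
summed by rows, giving `n³`, while a matched product factorises into two double sums, giving `n²`.
-/
lemma sum_four_le {a : ℕ → ℕ → ℝ} {R : ℝ} {n : ℕ}
    (ha : ∀ i, ∑ j ∈ Finset.range n, a i j ≤ R) (c : ℝ) (hc : 0 ≤ c) {b : ℕ → ℕ → ℝ} {N : ℝ}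
    (hb0 : ∀ i j, 0 ≤ b i j) (hb : ∀ i, ∑ j ∈ Finset.range n, b i j ≤ N) (c' : ℝ) (hc' : 0 ≤ c') :
    ∑ i ∈ Finset.range n, ∑ j ∈ Finset.range n, ∑ k ∈ Finset.range n, ∑ l ∈ Finset.range n,
      (c * (a i j + a i k + a i l + a j k + a j l + a k l) +
        c' * (b i j * b k l + b i k * b j l + b i l * b j k)) ≤
      c * (6 * n ^ 3 * R) + c' * (3 * (n * N) ^ 2) := by
  have hA : ∑ i ∈ Finset.range n, ∑ j ∈ Finset.range n, a i j ≤ n * R := by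
    refine (Finset.sum_le_card_nsmul _ _ R fun i _ => ha i).trans (by simp)
  have hN : 0 ≤ N := (Finset.sum_nonneg fun j _ => hb0 0 j).trans (hb 0)
  have hB : ∑ i ∈ Finset.range n, ∑ j ∈ Finset.range n, b i j ≤ n * N := by
    refine (Finset.sum_le_card_nsmul _ _ N fun i _ => hb i).trans (by simp)
  have hB0 : 0 ≤ ∑ i ∈ Finset.range n, ∑ j ∈ Finset.range n, b i j :=
    Finset.sum_nonneg fun i _ => Finset.sum_nonneg fun j _ => hb0 i j
  have hrow : ∑ i ∈ Finset.range n, ∑ j ∈ Finset.range n,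
      (∑ k ∈ Finset.range n, b i k) * ∑ l ∈ Finset.range n, b j l ≤ (n * N) ^ 2 := by
    rw [← Finset.sum_mul_sum, ← sq]
    exact pow_le_pow_left₀ hB0 hB 2
  have e1 : ∑ i ∈ Finset.range n, ∑ j ∈ Finset.range n, ∑ k ∈ Finset.range n,
      ∑ l ∈ Finset.range n, b i j * b k l ≤ (n * N) ^ 2 := by
    simp only [← Finset.mul_sum, ← Finset.sum_mul]
    rw [← sq]
    exact pow_le_pow_left₀ hB0 hB 2
  have e2 : ∑ i ∈ Finset.range n, ∑ j ∈ Finset.range n, ∑ k ∈ Finset.range n,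
      ∑ l ∈ Finset.range n, b i k * b j l ≤ (n * N) ^ 2 := by
    simpa only [← Finset.mul_sum, ← Finset.sum_mul] using hrow
  have e3 : ∑ i ∈ Finset.range n, ∑ j ∈ Finset.range n, ∑ k ∈ Finset.range n,
      ∑ l ∈ Finset.range n, b i l * b j k ≤ (n * N) ^ 2 := by
    simpa only [← Finset.mul_sum, ← Finset.sum_mul] using hrow
  have hn : (0 : ℝ) ≤ n := n.cast_nonneg
  have hA' : (n : ℝ) * (n * ∑ i ∈ Finset.range n, ∑ j ∈ Finset.range n, a i j) ≤ n ^ 3 * R := by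
    calc _ ≤ (n : ℝ) * (n * (n * R)) := by gcongr
      _ = _ := by ring
  simp only [Finset.sum_add_distrib, ← Finset.mul_sum, mul_add] at *
  simp only [Finset.sum_const, Finset.card_range, nsmul_eq_mul, ← Finset.mul_sum] at *
  nlinarith [mul_le_mul_of_nonneg_left hA' hc, mul_le_mul_of_nonneg_left e1 hc',
    mul_le_mul_of_nonneg_left e2 hc', mul_le_mul_of_nonneg_left e3 hc']

section

variable {Ω : Type*} [MeasurableSpace Ω] {P : Measure Ω} [IsProbabilityMeasure P]
  {X : ℕ → Ω → ℝ}

/-- A bounded symmetric kernel which is Lipschitz, has Lipschitz mixed increments, and is degenerate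
for the law of `Z`. -/
structure IsSmoothDegenerate (h : ℝ → ℝ → ℝ) (B L M : ℝ) (P : Measure Ω) (Z : Ω → ℝ) : Prop where
  measurable : Measurable (Function.uncurry h)
  symm : ∀ x y, h x y = h y x
  bound : ∀ x y, |h x y| ≤ B
  lipschitz : ∀ x x' y, |h x' y - h x y| ≤ L * |x' - x|
  mixed : ∀ x x' y y', |(h x' y' - h x' y) - (h x y' - h x y)| ≤ M * |x' - x| * |y' - y|
  degenerate : ∀ x, ∫ ω, h x (Z ω) ∂P = 0
  bound_nonneg : 0 ≤ B
  lipschitz_nonneg : 0 ≤ L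
  mixed_nonneg : 0 ≤ M

/-- View the product as a function of `(X i, X k, X l)` and of `w = X j`; only the first factor
involves `w`, so degeneracy survives. By the product rule for increments, its mixed increment meets
either the mixed increment of the first factor times a bound, `M * B`, or two Lipschitz increments,
`L * L`. -/
lemma IsSmoothDegenerate.abs_integral_mul_le {h : ℝ → ℝ → ℝ} {B L M : ℝ}
    (hh : IsSmoothDegenerate h B L M P (X 0)) (hassoc : IsAssociated X P)
    (hX : ∀ n, Measurable (X n)) (hstat : IsStrictlyStationary X P) {C : ℝ} (hC : 0 < C)
    (hXC : ∀ n, ∀ᵐ ω ∂P, |X n ω| ≤ C) (i j k l : ℕ) :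
    |∫ ω, h (X i ω) (X j ω) * h (X k ω) (X l ω) ∂P| ≤
      (M * B + L * L) * (cov[X i, X j; P] + cov[X k, X j; P] + cov[X l, X j; P]) := by
  obtain ⟨hm, hsymm, hB, hL, hM, hdeg, hB0, hL0, hM0⟩ := hh
  have hX2 : ∀ n, MemLp (X n) 2 P := fun n => .of_bound (hX n).aestronglyMeasurable C (hXC n)
  have hL' : ∀ x y y', |h x y' - h x y| ≤ L * |y' - y| := fun x y y' => by
    rw [hsymm x y', hsymm x y]; exact hL y y' x
  set Q : (ℕ → ℝ) → ℝ → ℝ := fun v w => h (v i) w * h (v k) (v l) with hQ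
  set T : (ℕ → ℝ) → ℝ := fun v => v i + v k + v l with hT
  have hk : ∀ v w : ℕ → ℝ, v ≤ w →
      |h (w k) (w l) - h (v k) (v l)| ≤ L * ((w k - v k) + (w l - v l)) := by
    intro v w hvw
    have h1 := hL (v k) (w k) (w l)
    have h2 := hL' (v k) (v l) (w l)
    rw [abs_of_nonneg (sub_nonneg.2 (hvw _))] at h1 h2
    have := abs_add_le (h (w k) (w l) - h (v k) (w l)) (h (v k) (w l) - h (v k) (v l))
    rw [sub_add_sub_cancel] at this
    linarith
  have hm2 : Measurable fun q : ℝ × ℝ => h q.1 q.2 := hm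
  have hQm : Measurable (Function.uncurry Q) := by
    have e1 : Measurable fun q : (ℕ → ℝ) × ℝ => h (q.1 i) q.2 :=
      hm2.comp (f := fun q : (ℕ → ℝ) × ℝ => (q.1 i, q.2)) (by fun_prop)
    have e2 : Measurable fun q : (ℕ → ℝ) × ℝ => h (q.1 k) (q.1 l) :=
      hm2.comp (f := fun q : (ℕ → ℝ) × ℝ => (q.1 k, q.1 l)) (by fun_prop)
    exact e1.mul e2
  have hT2 : MemLp (fun ω => T (path X ω)) 2 P := ((hX2 i).add (hX2 k)).add (hX2 l)
  have key := hassoc.abs_integral_le_of_degenerate hX (Q := Q) (T := T) ({i, k, l} : Finset ℕ) j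
    hQm (by fun_prop) (fun w a b hab => ?_) (fun a b hab => ?_) (B := B * B) (L := L * B)
    (M := M * B + L * L) (C := C) (by positivity) hC (by positivity) (fun v w => ?_)
    (fun v w w' => ?_) (fun w w' hww v v' hvv => ?_) (fun v => ?_) (hXC j) hT2
  · have hcov : cov[fun ω => T (path X ω), X j; P] =
        cov[X i, X j; P] + cov[X k, X j; P] + cov[X l, X j; P] := by
      rw [← covariance_add_left (hX2 i) (hX2 k) (hX2 j),
        ← covariance_add_left ((hX2 i).add (hX2 k)) (hX2 l) (hX2 j)]
      rfl
    rwa [hcov] at key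
  · simp only [hQ, hab i (by simp), hab k (by simp), hab l (by simp)]
  · simp only [hT, hab i (by simp), hab k (by simp), hab l (by simp)]
  · simp only [hQ, abs_mul]
    exact mul_le_mul (hB _ _) (hB _ _) (abs_nonneg _) hB0
  · simp only [hQ]
    rw [← sub_mul, abs_mul]
    calc _ ≤ (L * |w - w'|) * B := mul_le_mul (hL' _ _ _) (hB _ _) (abs_nonneg _) (by positivity)
      _ = _ := by ring
  · simp only [hQ, hT]
    have hw0 : 0 ≤ w' - w := sub_nonneg.2 hww
    have h1 := hM (v i) (v' i) w w'
    have h2 := hL' (v i) w w'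
    rw [abs_of_nonneg hw0] at h1 h2
    rw [abs_of_nonneg (sub_nonneg.2 (hvv i))] at h1
    have e : h (v' i) w' * h (v' k) (v' l) - h (v' i) w * h (v' k) (v' l) -
        (h (v i) w' * h (v k) (v l) - h (v i) w * h (v k) (v l)) =
        ((h (v' i) w' - h (v' i) w) - (h (v i) w' - h (v i) w)) * h (v' k) (v' l) +
        (h (v i) w' - h (v i) w) * (h (v' k) (v' l) - h (v k) (v l)) := by ring
    rw [e]
    refine (abs_add_le _ _).trans ?_
    rw [abs_mul, abs_mul]
    have hi : 0 ≤ v' i - v i := sub_nonneg.2 (hvv i)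
    have hkk : 0 ≤ v' k - v k := sub_nonneg.2 (hvv k)
    have hll : 0 ≤ v' l - v l := sub_nonneg.2 (hvv l)
    have g1 : |(h (v' i) w' - h (v' i) w) - (h (v i) w' - h (v i) w)| * |h (v' k) (v' l)| ≤
        M * (v' i - v i) * (w' - w) * B :=
      mul_le_mul h1 (hB _ _) (abs_nonneg _) (by positivity)
    have g2 : |h (v i) w' - h (v i) w| * |h (v' k) (v' l) - h (v k) (v l)| ≤
        L * (w' - w) * (L * ((v' k - v k) + (v' l - v l))) :=
      mul_le_mul h2 (hk v v' hvv) (abs_nonneg _) (by positivity)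
    have p1 : 0 ≤ M * B * (w' - w) * ((v' k - v k) + (v' l - v l)) := by positivity
    have p2 : 0 ≤ L * L * (w' - w) * (v' i - v i) := by positivity
    linarith
  · have hmx : Measurable (h (v i)) := hm2.comp (f := fun w => (v i, w)) (by fun_prop)
    have : ∫ ω, h (v i) (X j ω) ∂P = 0 := by
      rw [← hdeg (v i)]
      exact ((hstat.identDistrib_single hX j).comp hmx).integral_eq
    simp only [hQ]
    rw [integral_mul_const, this, zero_mul]

/-- The sum `∑_{i < j < n} h(X_i, X_j)`. -/
def pairSum (h : ℝ → ℝ → ℝ) (X : ℕ → Ω → ℝ) (n : ℕ) (ω : Ω) : ℝ :=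
  ∑ j ∈ Finset.range n, ∑ i ∈ Finset.range j, h (X i ω) (X j ω)

/-- The cutoff `K` separates quadruples with an isolated index, controlled by covariances at lags
beyond `K`, from those whose indices match in pairs, controlled by counting. -/
lemma IsSmoothDegenerate.integral_pairSum_sq_le {h : ℝ → ℝ → ℝ} {B L M : ℝ}
    (hh : IsSmoothDegenerate h B L M P (X 0)) (hassoc : IsAssociated X P)
    (hX : ∀ n, Measurable (X n)) (hstat : IsStrictlyStationary X P) {C : ℝ} (hC : 0 < C)
    (hXC : ∀ n, ∀ᵐ ω ∂P, |X n ω| ≤ C) (hcov : Summable fun d => cov[X 0, X d; P]) (n K : ℕ) :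
    ∫ ω, pairSum h X n ω ^ 2 ∂P ≤
      (M * B + L * L) * (6 * n ^ 3 * (2 * covTail P X id (K + 1))) +
        B ^ 2 * (3 * (n * (2 * (2 * K + 1))) ^ 2) := by
  have hX2 : ∀ n, MemLp (X n) 2 P := fun n => .of_bound (hX n).aestronglyMeasurable C (hXC n)
  have hc0 : ∀ i j, 0 ≤ cov[X i, X j; P] := hassoc.cov_single_nonneg monotone_id hX2
  set r : ℕ → ℝ := fun d => cov[X 0, X d; P] with hr
  have hceq : ∀ i j, cov[X i, X j; P] = r (Nat.dist i j) := fun i j =>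
    hstat.cov_eq hX measurable_id i j
  set φ : ℕ → ℝ := fun d => if K < d then r d else 0 with hφ
  have hφ0 : ∀ d, 0 ≤ φ d := fun d => by
    simp only [hφ]; split_ifs; exacts [hc0 0 d, le_rfl]
  have hφs : Summable φ := hcov.of_nonneg_of_le hφ0 fun d => by
    simp only [hφ]; split_ifs; exacts [le_rfl, hc0 0 d]
  have hφt : ∑' d, φ d = covTail P X id (K + 1) := by
    rw [← hφs.sum_add_tsum_nat_add (K + 1), Finset.sum_eq_zero, zero_add]
    · refine tsum_congr fun d => ?_
      simp only [hφ]
      rw [if_pos (by omega)]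
      rfl
    · intro d hd
      have := Finset.mem_range.1 hd
      simp only [hφ]
      rw [if_neg (by omega)]
  -- The threshold is `2 * K` rather than `K`: two indices may be close only through a common
  -- neighbour.
  set χ : ℕ → ℝ := fun d => if d ∈ Finset.range (2 * K + 1) then 1 else 0 with hχ
  have hχ0 : ∀ d, 0 ≤ χ d := fun d => by
    simp only [hχ]; split_ifs <;> norm_num
  have hχs : HasSum χ (2 * K + 1) := by
    have : HasSum χ (∑ d ∈ Finset.range (2 * K + 1), χ d) :=
      hasSum_sum_of_ne_finset_zero fun d hd => by simp only [hχ, if_neg hd]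
    convert this using 1
    simp only [hχ]
    rw [Finset.sum_ite_mem, Finset.inter_self]
    simp
  have hχn : ∀ {d}, d ≤ 2 * K → χ d = 1 := fun {d} hd => by
    simp only [hχ]; rw [if_pos (Finset.mem_range.2 (by omega))]
  set a : ℕ → ℕ → ℝ := fun i j => φ (Nat.dist i j) with ha
  set b : ℕ → ℕ → ℝ := fun i j => χ (Nat.dist i j) with hb
  have hfar : ∀ {i j}, K < Nat.dist i j → cov[X i, X j; P] = a i j := fun {i j} hij => by
    simp only [ha, hφ]; rw [if_pos hij, hceq]
  have hm2 : Measurable fun q : ℝ × ℝ => h q.1 q.2 := hh.measurable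
  have hmij : ∀ i j, Measurable fun ω => h (X i ω) (X j ω) := fun i j =>
    hm2.comp ((hX i).prodMk (hX j))
  have hij2 : ∀ i j, MemLp (fun ω => h (X i ω) (X j ω)) 2 P := fun i j =>
    .of_bound (hmij i j).aestronglyMeasurable B (.of_forall fun _ => hh.bound _ _)
  have hint : ∀ i j k l, Integrable (fun ω => h (X i ω) (X j ω) * h (X k ω) (X l ω)) P :=
    fun i j k l => (hij2 i j).integrable_mul (hij2 k l)
  set M' := M * B + L * L
  have hM' : 0 ≤ M' := by
    have := hh.bound_nonneg; have := hh.lipschitz_nonneg; have := hh.mixed_nonneg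
    positivity
  have hterm : ∀ i j k l, |∫ ω, h (X i ω) (X j ω) * h (X k ω) (X l ω) ∂P| ≤
      M' * (a i j + a i k + a i l + a j k + a j l + a k l) +
        B ^ 2 * (b i j * b k l + b i k * b j l + b i l * b j k) := by
    intro i j k l
    have ha0 : ∀ i j, 0 ≤ a i j := fun i j => hφ0 _
    have hb0 : ∀ i j, 0 ≤ b i j := fun i j => hχ0 _
    have acomm : ∀ i j, a i j = a j i := fun i j => by simp only [ha, Nat.dist_comm]
    have hbsum : 0 ≤ b i j * b k l + b i k * b j l + b i l * b j k :=
      add_nonneg (add_nonneg (mul_nonneg (hb0 _ _) (hb0 _ _)) (mul_nonneg (hb0 _ _) (hb0 _ _)))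
        (mul_nonneg (hb0 _ _) (hb0 _ _))
    have hasum : 0 ≤ a i j + a i k + a i l + a j k + a j l + a k l := by
      have := ha0 i j; have := ha0 i k; have := ha0 i l
      have := ha0 j k; have := ha0 j l; have := ha0 k l
      positivity
    have far : ∀ i j k l, K < Nat.dist i j → K < Nat.dist k j → K < Nat.dist l j →
        |∫ ω, h (X i ω) (X j ω) * h (X k ω) (X l ω) ∂P| ≤ M' * (a i j + a k j + a l j) := by
      intro i j k l h1 h2 h3
      have := hh.abs_integral_mul_le hassoc hX hstat hC hXC i j k l
      rwa [hfar h1, hfar h2, hfar h3] at this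
    have fin : ∀ {s : ℝ}, s ≤ a i j + a i k + a i l + a j k + a j l + a k l →
        |∫ ω, h (X i ω) (X j ω) * h (X k ω) (X l ω) ∂P| ≤ M' * s →
        |∫ ω, h (X i ω) (X j ω) * h (X k ω) (X l ω) ∂P| ≤
        M' * (a i j + a i k + a i l + a j k + a j l + a k l) +
          B ^ 2 * (b i j * b k l + b i k * b j l + b i l * b j k) := by
      intro s hs h1
      have := mul_le_mul_of_nonneg_left hs hM'
      have := mul_nonneg (sq_nonneg B) hbsum
      linarith
    -- Symmetry of `h` and commutativity move any isolated index into the slot treated by `far`.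
    have swap : ∀ i j k l, ∫ ω, h (X i ω) (X j ω) * h (X k ω) (X l ω) ∂P =
        ∫ ω, h (X j ω) (X i ω) * h (X k ω) (X l ω) ∂P := fun i j k l => by
      simp only [hh.symm (X i _) (X j _)]
    have exch : ∀ i j k l, ∫ ω, h (X i ω) (X j ω) * h (X k ω) (X l ω) ∂P =
        ∫ ω, h (X k ω) (X l ω) * h (X i ω) (X j ω) ∂P := fun i j k l => by
      simp only [mul_comm]
    have dc : ∀ i j, Nat.dist i j = Nat.dist j i := Nat.dist_comm
    by_cases hj : K < Nat.dist i j ∧ K < Nat.dist k j ∧ K < Nat.dist l j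
    · refine fin ?_ (far i j k l hj.1 hj.2.1 hj.2.2)
      rw [acomm k j, acomm l j]
      linarith [ha0 i k, ha0 i l, ha0 k l]
    by_cases hi : K < Nat.dist j i ∧ K < Nat.dist k i ∧ K < Nat.dist l i
    · rw [swap] at fin ⊢
      refine fin ?_ (far j i k l hi.1 hi.2.1 hi.2.2)
      rw [acomm j i, acomm k i, acomm l i]
      linarith [ha0 j k, ha0 j l, ha0 k l]
    by_cases hl : K < Nat.dist k l ∧ K < Nat.dist i l ∧ K < Nat.dist j l
    · rw [exch] at fin ⊢
      refine fin ?_ (far k l i j hl.1 hl.2.1 hl.2.2)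
      linarith [ha0 i j, ha0 i k, ha0 j k]
    by_cases hk : K < Nat.dist l k ∧ K < Nat.dist i k ∧ K < Nat.dist j k
    · rw [exch, swap] at fin ⊢
      refine fin ?_ (far l k i j hk.1 hk.2.1 hk.2.2)
      rw [acomm l k]
      linarith [ha0 i j, ha0 i l, ha0 j l]
    -- Join indices at distance at most `K`. A graph on four vertices with no isolated vertex either
    -- has a perfect matching or is a star; in a star any two leaves are within `2 * K`.
    have hmatch : (Nat.dist i j ≤ 2 * K ∧ Nat.dist k l ≤ 2 * K) ∨
        (Nat.dist i k ≤ 2 * K ∧ Nat.dist j l ≤ 2 * K) ∨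
        (Nat.dist i l ≤ 2 * K ∧ Nat.dist j k ≤ 2 * K) := by
      have tri : ∀ x y z, Nat.dist x z ≤ Nat.dist x y + Nat.dist y z :=
        Nat.dist.triangle_inequality
      have t1 := tri i j k; have t2 := tri i j l; have t3 := tri i k l; have t4 := tri j k l
      have t5 := tri i k j; have t6 := tri i l j; have t7 := tri i l k; have t8 := tri j l k
      have t9 := tri j i k; have t10 := tri j i l; have t11 := tri k i l; have t12 := tri k j l
      rw [dc k j] at *
      rw [dc l j] at *
      rw [dc j i] at *
      rw [dc k i] at *
      rw [dc l i] at *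
      rw [dc l k] at *
      generalize Nat.dist i j = d1 at *
      generalize Nat.dist i k = d2 at *
      generalize Nat.dist i l = d3 at *
      generalize Nat.dist j k = d4 at *
      generalize Nat.dist j l = d5 at *
      generalize Nat.dist k l = d6 at *
      omega
    have hone : 1 ≤ b i j * b k l + b i k * b j l + b i l * b j k := by
      have q1 := mul_nonneg (hb0 i j) (hb0 k l)
      have q2 := mul_nonneg (hb0 i k) (hb0 j l)
      have q3 := mul_nonneg (hb0 i l) (hb0 j k)
      rcases hmatch with ⟨u, v⟩ | ⟨u, v⟩ | ⟨u, v⟩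
      · have : b i j * b k l = 1 := by simp only [hb, hχn u, hχn v, mul_one]
        linarith
      · have : b i k * b j l = 1 := by simp only [hb, hχn u, hχn v, mul_one]
        linarith
      · have : b i l * b j k = 1 := by simp only [hb, hχn u, hχn v, mul_one]
        linarith
    have hle : |∫ ω, h (X i ω) (X j ω) * h (X k ω) (X l ω) ∂P| ≤ B ^ 2 := by
      refine abs_integral_le_integral_abs.trans ?_
      refine (integral_mono (hint i j k l).abs (integrable_const (B ^ 2)) fun ω => ?_).trans ?_
      · simp only [abs_mul]
        rw [sq]
        exact mul_le_mul (hh.bound _ _) (hh.bound _ _) (abs_nonneg _) hh.bound_nonneg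
      · simp
    have := mul_le_mul_of_nonneg_left hone (sq_nonneg B)
    have := mul_nonneg hM' hasum
    linarith
  have hexp : ∫ ω, pairSum h X n ω ^ 2 ∂P = ∑ j ∈ Finset.range n, ∑ i ∈ Finset.range j,
      ∑ l ∈ Finset.range n, ∑ k ∈ Finset.range l,
        ∫ ω, h (X i ω) (X j ω) * h (X k ω) (X l ω) ∂P := by
    simp only [pairSum, sq, Finset.sum_mul]
    simp only [Finset.mul_sum]
    rw [integral_finsetSum _ fun j _ => integrable_finsetSum _ fun i _ =>
      integrable_finsetSum _ fun l _ => integrable_finsetSum _ fun k _ => hint i j k l]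
    refine Finset.sum_congr rfl fun j _ => ?_
    rw [integral_finsetSum _ fun i _ =>
      integrable_finsetSum _ fun l _ => integrable_finsetSum _ fun k _ => hint i j k l]
    refine Finset.sum_congr rfl fun i _ => ?_
    rw [integral_finsetSum _ fun l _ => integrable_finsetSum _ fun k _ => hint i j k l]
    refine Finset.sum_congr rfl fun l _ => ?_
    rw [integral_finsetSum _ fun k _ => hint i j k l]
  rw [hexp]
  have hsub : ∀ {j}, j ∈ Finset.range n → Finset.range j ⊆ Finset.range n := fun {j} hj =>
    Finset.range_subset_range.2 (Finset.mem_range.1 hj).le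
  calc ∑ j ∈ Finset.range n, ∑ i ∈ Finset.range j, ∑ l ∈ Finset.range n, ∑ k ∈ Finset.range l,
        ∫ ω, h (X i ω) (X j ω) * h (X k ω) (X l ω) ∂P
      ≤ ∑ j ∈ Finset.range n, ∑ i ∈ Finset.range n, ∑ l ∈ Finset.range n, ∑ k ∈ Finset.range n,
        |∫ ω, h (X i ω) (X j ω) * h (X k ω) (X l ω) ∂P| := by
        refine Finset.sum_le_sum fun j hj => ?_
        refine (Finset.sum_le_sum fun i _ => ?_).trans (Finset.sum_le_sum_of_subset_of_nonneg
          (hsub hj) fun i _ _ => Finset.sum_nonneg fun l _ => Finset.sum_nonneg fun k _ =>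
            abs_nonneg _)
        refine Finset.sum_le_sum fun l hl => ?_
        exact (Finset.sum_le_sum fun k _ => le_abs_self _).trans
          (Finset.sum_le_sum_of_subset_of_nonneg (hsub hl) fun k _ _ => abs_nonneg _)
    _ ≤ ∑ j ∈ Finset.range n, ∑ i ∈ Finset.range n, ∑ l ∈ Finset.range n, ∑ k ∈ Finset.range n,
        (M' * (a j i + a j l + a j k + a i l + a i k + a l k) +
          B ^ 2 * (b j i * b l k + b j l * b i k + b j k * b i l)) := by
        refine Finset.sum_le_sum fun j _ => Finset.sum_le_sum fun i _ =>
          Finset.sum_le_sum fun l _ => Finset.sum_le_sum fun k _ => ?_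
        refine (hterm i j k l).trans (le_of_eq ?_)
        simp only [ha, hb, Nat.dist_comm j i, Nat.dist_comm l k]
        ring
    _ ≤ _ := by
        refine sum_four_le (fun i => ?_) M' hM' (fun i j => hχ0 _) (fun i => ?_) _ (sq_nonneg B)
        · rw [← hφt]; exact sum_range_dist_le hφ0 hφs n i
        · rw [← hχs.tsum_eq]; exact sum_range_dist_le hχ0 hχs.summable n i

lemma IsSmoothDegenerate.tendsto_integral_pairSum_sq {h : ℝ → ℝ → ℝ} {B L M : ℝ}
    (hh : IsSmoothDegenerate h B L M P (X 0)) (hassoc : IsAssociated X P)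
    (hX : ∀ n, Measurable (X n)) (hstat : IsStrictlyStationary X P) {C : ℝ} (hC : 0 < C)
    (hXC : ∀ n, ∀ᵐ ω ∂P, |X n ω| ≤ C) (hcov : Summable fun d => cov[X 0, X d; P]) :
    Tendsto (fun n : ℕ => (∫ ω, pairSum h X n ω ^ 2 ∂P) / n ^ 3) atTop (𝓝 0) := by
  rw [Metric.tendsto_atTop]
  intro ε hε
  set M' := M * B + L * L
  have h1 : Tendsto (fun K : ℕ => M' * (6 * (2 * covTail P X id (K + 1)))) atTop (𝓝 0) := by
    simpa using ((((tendsto_add_atTop_iff_nat 1).2 (tendsto_covTail P X id)).const_mul 2).const_mul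
      6).const_mul M'
  -- `K` is chosen from the covariance tail alone; the remaining term is then of order `1 / n`.
  obtain ⟨K, hK⟩ := (h1.eventually_lt_const (half_pos hε)).exists
  have h2 := (tendsto_const_div_atTop_nhds_zero_nat
    (B ^ 2 * (3 * (2 * (2 * (K : ℝ) + 1)) ^ 2))).eventually_lt_const (half_pos hε)
  obtain ⟨N, hN⟩ := eventually_atTop.1 (h2.and (eventually_gt_atTop 0))
  refine ⟨N, fun n hn => ?_⟩
  obtain ⟨hn1, hn0⟩ := hN n hn
  have hnpos : (0 : ℝ) < n := by exact_mod_cast hn0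
  have h0 : 0 ≤ ∫ ω, pairSum h X n ω ^ 2 ∂P := integral_nonneg fun ω => sq_nonneg _
  rw [Real.dist_0_eq_abs, abs_of_nonneg (by positivity), div_lt_iff₀ (by positivity)]
  refine (hh.integral_pairSum_sq_le hassoc hX hstat hC hXC hcov n K).trans_lt ?_
  have e : M' * (6 * n ^ 3 * (2 * covTail P X id (K + 1))) +
      B ^ 2 * (3 * (n * (2 * (2 * K + 1))) ^ 2) =
      (M' * (6 * (2 * covTail P X id (K + 1))) +
        B ^ 2 * (3 * (2 * (2 * (K : ℝ) + 1)) ^ 2) / n) * (n : ℝ) ^ 3 := by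
    field_simp
  rw [e]
  exact mul_lt_mul_of_pos_right (by linarith) (by positivity)

end

/-! ### Regularity of the kernel from that of its tensor square. -/

lemma update_vec_zero (x y a b t : ℝ) : Function.update ![x, y, a, b] 0 t = ![t, y, a, b] := by
  ext i; fin_cases i <;> rfl

lemma update_vec_one (x y a b t : ℝ) : Function.update ![x, y, a, b] 1 t = ![x, t, a, b] := by
  ext i; fin_cases i <;> rfl

/-- If `h(x, y) h(x', y')` has bounded second-order partial derivatives on a cube, then on the square
`h` is bounded, Lipschitz in the first variable, and has Lipschitz mixed increments. -/
lemma HasBoundedSecondPartials.exists_bounds {h : ℝ → ℝ → ℝ} {C : ℝ} (hC : 0 < C)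
    (hsymm : ∀ x y, h x y = h y x)
    (hG : HasBoundedSecondPartials (Set.Icc (-C) C)
      (fun z : Fin 4 → ℝ => h (z 0) (z 1) * h (z 2) (z 3))) :
    ∃ B L M : ℝ, 0 ≤ B ∧ 0 ≤ L ∧ 0 ≤ M ∧ ∀ x ∈ Set.Icc (-C) C, ∀ x' ∈ Set.Icc (-C) C,
      ∀ y ∈ Set.Icc (-C) C, ∀ y' ∈ Set.Icc (-C) C, |h x y| ≤ B ∧ |h x' y - h x y| ≤ L * |x' - x| ∧
        |(h x' y' - h x' y) - (h x y' - h x y)| ≤ M * |x' - x| * |y' - y| := by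
  set I := Set.Icc (-C) C with hI
  by_cases hz : ∀ x ∈ I, ∀ y ∈ I, h x y = 0
  · refine ⟨0, 0, 0, le_rfl, le_rfl, le_rfl, fun x hx x' hx' y hy y' hy' => ?_⟩
    simp [hz x hx y hy, hz x' hx' y hy, hz x hx y' hy', hz x' hx' y' hy']
  push Not at hz
  -- Freezing the last two arguments at a point where `h` does not vanish makes the product `c * h`,
  -- and every bound can be divided by `|c|`.
  obtain ⟨a, ha, b, hb, hc⟩ := hz
  obtain ⟨hd1, hd2, M, hM⟩ := hG
  set G : (Fin 4 → ℝ) → ℝ := fun z => h (z 0) (z 1) * h (z 2) (z 3) with hGdef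
  set c := h a b with hcdef
  set g : ℝ → ℝ → ℝ := fun x y => h x y * c with hg
  have hmem : ∀ {x y}, x ∈ I → y ∈ I → ∀ k, (![x, y, a, b] : Fin 4 → ℝ) k ∈ I := by
    intro x y hx hy k
    fin_cases k
    exacts [hx, hy, ha, hb]
  set D : ℝ → ℝ → ℝ := fun x y => derivWithin (fun t => g t y) I x with hD
  have hDeq : ∀ x y, partialWithin I 0 G ![x, y, a, b] = D x y := by
    intro x y
    simp only [partialWithin, update_vec_zero]
    rfl
  have hgd : ∀ x ∈ I, ∀ y ∈ I, DifferentiableWithinAt ℝ (fun t => g t y) I x := by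
    intro x hx y hy
    have := hd1 0 _ (hmem hx hy)
    simp only [update_vec_zero] at this
    exact this
  have hD1 : ∀ x ∈ I, ∀ y ∈ I, DifferentiableWithinAt ℝ (fun t => D x t) I y := by
    intro x hx y hy
    have := hd2 0 1 _ (hmem hx hy)
    simp only [update_vec_one, hDeq] at this
    exact this
  have hD0 : ∀ x ∈ I, ∀ y ∈ I, DifferentiableWithinAt ℝ (fun t => D t y) I x := by
    intro x hx y hy
    have := hd2 0 0 _ (hmem hx hy)
    simp only [update_vec_zero, hDeq] at this
    exact this
  have hM1 : ∀ x ∈ I, ∀ y ∈ I, |derivWithin (fun t => D x t) I y| ≤ M := by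
    intro x hx y hy
    have := hM 0 1 _ (hmem hx hy)
    rw [partialWithin] at this
    simp only [update_vec_one, hDeq] at this
    exact this
  have hM0 : ∀ x ∈ I, ∀ y ∈ I, |derivWithin (fun t => D t y) I x| ≤ M := by
    intro x hx y hy
    have := hM 0 0 _ (hmem hx hy)
    rw [partialWithin] at this
    simp only [update_vec_zero, hDeq] at this
    exact this
  have hconv : Convex ℝ I := convex_Icc _ _
  have h0 : (0 : ℝ) ∈ I := ⟨by linarith, hC.le⟩
  have hMnn : 0 ≤ M := (abs_nonneg _).trans (hM0 0 h0 0 h0)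
  have hDy : ∀ x ∈ I, ∀ y ∈ I, ∀ y' ∈ I, |D x y' - D x y| ≤ M * |y' - y| :=
    fun x hx y hy y' hy' => hconv.norm_image_sub_le_of_norm_derivWithin_le
      (f := fun t => D x t) (fun t ht => hD1 x hx t ht) (hM1 x hx) hy hy'
  have hDx : ∀ y ∈ I, ∀ x ∈ I, ∀ x' ∈ I, |D x' y - D x y| ≤ M * |x' - x| :=
    fun y hy x hx x' hx' => hconv.norm_image_sub_le_of_norm_derivWithin_le
      (f := fun t => D t y) (fun t ht => hD0 t ht y hy) (fun t ht => hM0 t ht y hy) hx hx'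
  have habs : ∀ x ∈ I, |x - 0| ≤ C := fun x hx => by
    rw [sub_zero]; exact abs_le.2 hx
  -- The first derivative is not assumed bounded: it is Lipschitz in each variable by the
  -- second-order bounds, and the cube is bounded.
  have hDB : ∀ x ∈ I, ∀ y ∈ I, |D x y| ≤ |D 0 0| + 2 * M * C := by
    intro x hx y hy
    have h1 := (hDy x hx 0 h0 y hy).trans (mul_le_mul_of_nonneg_left (habs y hy) hMnn)
    have h2 := (hDx 0 h0 0 h0 x hx).trans (mul_le_mul_of_nonneg_left (habs x hx) hMnn)
    have h3 := abs_add_three (D x y - D x 0) (D x 0 - D 0 0) (D 0 0)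
    rw [sub_add_sub_cancel, sub_add_cancel] at h3
    linarith
  set L := |D 0 0| + 2 * M * C with hL
  have hLnn : 0 ≤ L := by positivity
  have hgx : ∀ y ∈ I, ∀ x ∈ I, ∀ x' ∈ I, |g x' y - g x y| ≤ L * |x' - x| :=
    fun y hy x hx x' hx' => hconv.norm_image_sub_le_of_norm_derivWithin_le
      (f := fun t => g t y) (fun t ht => hgd t ht y hy) (fun t ht => hDB t ht y hy) hx hx'
  have hgsymm : ∀ x y, g x y = g y x := fun x y => by simp only [hg, hsymm x y]
  have hgB : ∀ x ∈ I, ∀ y ∈ I, |g x y| ≤ |g 0 0| + 2 * L * C := by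
    intro x hx y hy
    have h1 := (hgx y hy 0 h0 x hx).trans (mul_le_mul_of_nonneg_left (habs x hx) hLnn)
    have h2 := (hgx 0 h0 0 h0 y hy).trans (mul_le_mul_of_nonneg_left (habs y hy) hLnn)
    rw [hgsymm y 0] at h2
    have h3 := abs_add_three (g x y - g 0 y) (g 0 y - g 0 0) (g 0 0)
    rw [sub_add_sub_cancel, sub_add_cancel] at h3
    linarith
  have hgmix : ∀ x ∈ I, ∀ x' ∈ I, ∀ y ∈ I, ∀ y' ∈ I,
      |(g x' y' - g x' y) - (g x y' - g x y)| ≤ M * |y' - y| * |x' - x| := by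
    intro x hx x' hx' y hy y' hy'
    -- Mean value inequality in `x` for `g · y' - g · y`, whose derivative is small because `D` is
    -- Lipschitz in `y`.
    exact hconv.norm_image_sub_le_of_norm_hasDerivWithin_le (f := fun t => g t y' - g t y)
      (f' := fun t => D t y' - D t y)
      (fun t ht => (hgd t ht y' hy').hasDerivWithinAt.sub (hgd t ht y hy).hasDerivWithinAt)
      (fun t ht => hDy t ht y hy y' hy') hx hx'
  have hcpos : 0 < |c| := abs_pos.2 hc
  refine ⟨(|g 0 0| + 2 * L * C) / |c|, L / |c|, M / |c|, by positivity, by positivity,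
    by positivity, fun x hx x' hx' y hy y' hy' => ⟨?_, ?_, ?_⟩⟩
  · rw [le_div_iff₀ hcpos, ← abs_mul]
    exact hgB x hx y hy
  · rw [div_mul_eq_mul_div, le_div_iff₀ hcpos, ← abs_mul, sub_mul]
    exact hgx y hy x hx x' hx'
  · rw [div_mul_eq_mul_div, div_mul_eq_mul_div, le_div_iff₀ hcpos, ← abs_mul, sub_mul, sub_mul,
      sub_mul]
    exact (hgmix x hx x' hx' y hy y' hy').trans (le_of_eq (by ring))

/-! ### Clipping, Hoeffding decomposition and negligibility of the remainder. -/

/-- Truncation to `[-C, C]`. -/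
def clip (C x : ℝ) : ℝ := max (-C) (min x C)

lemma clip_mem {C : ℝ} (hC : 0 < C) (x : ℝ) : clip C x ∈ Set.Icc (-C) C :=
  ⟨le_max_left _ _, max_le (by linarith) (min_le_right _ _)⟩

lemma clip_of_abs_le {C x : ℝ} (h : |x| ≤ C) : clip C x = x := by
  have := abs_le.1 h
  rw [clip, min_eq_left this.2, max_eq_right this.1]

lemma abs_clip_sub_le (C x y : ℝ) : |clip C x - clip C y| ≤ |x - y| := by
  unfold clip
  refine (abs_max_sub_max_le_max _ _ _ _).trans ?_
  rw [sub_self, abs_zero]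
  refine max_le (abs_nonneg _) ((abs_min_sub_min_le_max _ _ _ _).trans ?_)
  simp

lemma measurable_clip (C : ℝ) : Measurable (clip C) := by
  unfold clip; fun_prop

lemma measurable_rhoOne {ρ : ℝ → ℝ → ℝ} (hρ : Measurable (Function.uncurry ρ)) (F : Measure ℝ)
    [SFinite F] : Measurable (rhoOne ρ F) :=
  (hρ.stronglyMeasurable.integral_prod_right (ν := F)).measurable

lemma hTwo_symm {ρ : ℝ → ℝ → ℝ} (hsymm : ∀ x y, ρ x y = ρ y x) (F : Measure ℝ) (x y : ℝ) :
    hTwo ρ F x y = hTwo ρ F y x := by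
  unfold hTwo; rw [hsymm x y]; ring

lemma integral_rhoOne {ρ : ℝ → ℝ → ℝ} {F : Measure ℝ} [SFinite F]
    (hint : Integrable (Function.uncurry ρ) (F.prod F)) : ∫ x, rhoOne ρ F x ∂F = theta ρ F :=
  (integral_prod _ hint).symm

lemma integral_hTwo {ρ : ℝ → ℝ → ℝ} {F : Measure ℝ} [IsProbabilityMeasure F]
    (hint : Integrable (Function.uncurry ρ) (F.prod F)) {x : ℝ} (hx : Integrable (ρ x) F) :
    ∫ y, hTwo ρ F x y ∂F = 0 := by
  have h1 : Integrable (rhoOne ρ F) F := hint.integral_prod_left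
  have h2 : Integrable (fun y => ρ x y - rhoOne ρ F x) F := hx.sub (integrable_const _)
  have h3 : Integrable (fun y => ρ x y - rhoOne ρ F x - rhoOne ρ F y) F := h2.sub h1
  unfold hTwo
  rw [integral_add h3 (integrable_const _), integral_sub h2 h1, integral_sub hx (integrable_const _),
    integral_rhoOne hint]
  simp [rhoOne]

/-- **Hoeffding decomposition** of the U-statistic. -/
lemma uStat_sub_theta {Ω : Type*} (ρ : ℝ → ℝ → ℝ) (F : Measure ℝ) (X : ℕ → Ω → ℝ) {n : ℕ}
    (hn : 2 ≤ n) (ω : Ω) :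
    uStat ρ X n ω - theta ρ F =
      2 / n * ∑ i ∈ Finset.range n, (rhoOne ρ F (X i ω) - theta ρ F) +
        (n.choose 2 : ℝ)⁻¹ * pairSum (hTwo ρ F) X n ω := by
  set θ := theta ρ F
  set f : ℕ → ℝ := fun i => rhoOne ρ F (X i ω) - θ with hf
  -- Each index lies in `m - 1` pairs, hence the coefficient of the linear part.
  have key : ∀ m : ℕ, ∑ j ∈ Finset.range m, ∑ i ∈ Finset.range j, ρ (X i ω) (X j ω) =
      pairSum (hTwo ρ F) X m ω + ((m : ℝ) - 1) * ∑ i ∈ Finset.range m, f i +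
        m * (m - 1) / 2 * θ := by
    intro m
    induction m with
    | zero => simp [pairSum]
    | succ m ih =>
      have e : ∀ i, ρ (X i ω) (X m ω) = hTwo ρ F (X i ω) (X m ω) + f i + f m + θ := fun i => by
        simp only [hf, hTwo]; ring
      rw [Finset.sum_range_succ, ih]
      simp only [e, pairSum, Finset.sum_range_succ _ m, Finset.sum_add_distrib, Finset.sum_const,
        Finset.card_range, nsmul_eq_mul]
      push_cast
      ring
  have hn2 : (2 : ℝ) ≤ n := by exact_mod_cast hn
  have hn1 : (n : ℝ) - 1 ≠ 0 := by linarith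
  have hn0 : (n : ℝ) ≠ 0 := by linarith
  rw [uStat, key, Nat.cast_choose_two]
  field_simp
  ring

/-- The cube roots tend to zero, so eventually `a ≤ 1` and the covariance `a ^ 3` is at most `a`. -/
lemma summable_cov_of_rpow {Ω : Type*} [MeasurableSpace Ω] {P : Measure Ω} {X : ℕ → Ω → ℝ}
    (hc : ∀ d, 0 ≤ cov[X 0, X d; P])
    (h : Summable fun d : ℕ => cov[X 0, X d; P] ^ (1 / 3 : ℝ)) :
    Summable fun d => cov[X 0, X d; P] := by
  refine Summable.of_norm_bounded_eventually_nat h ?_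
  filter_upwards [h.tendsto_atTop_zero.eventually_le_const one_pos] with d hd
  rw [Real.norm_of_nonneg (hc d)]
  set a := cov[X 0, X d; P] ^ (1 / 3 : ℝ) with ha
  have ha0 : 0 ≤ a := Real.rpow_nonneg (hc d) _
  have e : cov[X 0, X d; P] = a ^ 3 := by
    rw [ha, ← Real.rpow_natCast, ← Real.rpow_mul (hc d)]
    norm_num
  rw [e]
  exact pow_le_of_le_one ha0 hd (by norm_num)

section

variable {Ω : Type*} [MeasurableSpace Ω] {P : Measure Ω} [IsProbabilityMeasure P]
  {X : ℕ → Ω → ℝ}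

lemma sq_integral_abs_le {D : Ω → ℝ} (hD : MemLp D 2 P) :
    (∫ ω, |D ω| ∂P) ^ 2 ≤ ∫ ω, D ω ^ 2 ∂P := by
  have h := variance_nonneg (fun ω => |D ω|) P
  have hD' : MemLp (fun ω => |D ω|) 2 P := hD.abs
  rw [variance_eq_sub hD'] at h
  have e : ∫ ω, ((fun ω => |D ω|) ^ 2) ω ∂P = ∫ ω, D ω ^ 2 ∂P := by
    simp only [Pi.pow_apply, sq_abs]
  rw [e] at h
  linarith

lemma NewmanDominated.monotone {f u : ℝ → ℝ} (h : NewmanDominated f u) : Monotone u :=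
  fun x y hxy => by
    have h1 := h.1 hxy
    have h2 := h.2 hxy
    simp only at h1 h2
    linarith

lemma sigmaSq_sub_const {f : ℝ → ℝ} (hf : ∀ i, MemLp (fun ω => f (X i ω)) 2 P) (c : ℝ) :
    sigmaSq (fun x => f x - c) X P = sigmaSq f X P := by
  have hi := fun i => (hf i).integrable (q := 2) (by norm_num)
  unfold sigmaSq
  rw [variance_sub_const (hf 0).aestronglyMeasurable]
  congr 2
  refine tsum_congr fun d => ?_
  rw [covariance_sub_const_left (hi 0), covariance_sub_const_right (hi _)]

/-- The truncated degenerate component of the Hoeffding decomposition. -/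
lemma exists_isSmoothDegenerate_hTwo_clip (hX : ∀ n, Measurable (X n)) {C : ℝ} (hC : 0 < C)
    (hXC : ∀ n, ∀ᵐ ω ∂P, |X n ω| ≤ C) {ρ : ℝ → ℝ → ℝ} (hρ : Measurable (Function.uncurry ρ))
    (hsymm : ∀ x y, ρ x y = ρ y x)
    (hint : Integrable (Function.uncurry ρ) ((P.map (X 0)).prod (P.map (X 0))))
    (hint₁ : ∀ x, Integrable (ρ x) (P.map (X 0)))
    (hsmooth : HasBoundedSecondPartials (Set.Icc (-C) C) (fun z : Fin 4 → ℝ =>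
      hTwo ρ (P.map (X 0)) (z 0) (z 1) * hTwo ρ (P.map (X 0)) (z 2) (z 3))) :
    ∃ B L M : ℝ, IsSmoothDegenerate (fun x y => hTwo ρ (P.map (X 0)) (clip C x) (clip C y))
      B L M P (X 0) := by
  have : IsProbabilityMeasure (P.map (X 0)) :=
    Measure.isProbabilityMeasure_map (hX 0).aemeasurable
  set F := P.map (X 0)
  have hs2 := hTwo_symm hsymm F
  obtain ⟨B, L, M, hB0, hL0, hM0, hb⟩ := hsmooth.exists_bounds hC hs2
  have hm1 := measurable_rhoOne hρ F
  have hm2 : Measurable fun q : ℝ × ℝ => hTwo ρ F q.1 q.2 :=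
    ((hρ.sub (hm1.comp measurable_fst)).sub (hm1.comp measurable_snd)).add_const _
  have hcl := fun x => clip_mem hC x
  refine ⟨B, L, M, ⟨?_, fun x y => hs2 _ _, fun x y => ?_, fun x x' y => ?_,
    fun x x' y y' => ?_, fun x => ?_, hB0, hL0, hM0⟩⟩
  · exact hm2.comp (((measurable_clip C).comp measurable_fst).prodMk
      ((measurable_clip C).comp measurable_snd))
  · exact (hb _ (hcl x) _ (hcl x) _ (hcl y) _ (hcl y)).1
  · exact (hb _ (hcl x) _ (hcl x') _ (hcl y) _ (hcl y)).2.1.trans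
      (mul_le_mul_of_nonneg_left (abs_clip_sub_le _ _ _) hL0)
  · refine (hb _ (hcl x) _ (hcl x') _ (hcl y) _ (hcl y')).2.2.trans ?_
    exact mul_le_mul (mul_le_mul_of_nonneg_left (abs_clip_sub_le _ _ _) hM0)
      (abs_clip_sub_le _ _ _) (abs_nonneg _) (by positivity)
  · have hmx : Measurable (hTwo ρ F (clip C x)) :=
      hm2.comp (f := fun y => (clip C x, y)) (by fun_prop)
    rw [← integral_hTwo hint (hint₁ (clip C x)),
      integral_map (hX 0).aemeasurable hmx.aestronglyMeasurable]
    refine integral_congr_ae ?_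
    filter_upwards [hXC 0] with ω hω
    rw [clip_of_abs_le hω]

/-- A scaled degenerate U-statistic `√n (n choose 2)⁻¹ ∑_{i<j} h(X_i, X_j)` tends to `0` in `L¹`. -/
lemma IsSmoothDegenerate.tendsto_integral_abs {h : ℝ → ℝ → ℝ} {B L M : ℝ}
    (hh : IsSmoothDegenerate h B L M P (X 0)) (hassoc : IsAssociated X P)
    (hX : ∀ n, Measurable (X n)) (hstat : IsStrictlyStationary X P) {C : ℝ} (hC : 0 < C)
    (hXC : ∀ n, ∀ᵐ ω ∂P, |X n ω| ≤ C) (hcov : Summable fun d => cov[X 0, X d; P]) :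
    (∀ n, MemLp (pairSum h X n) 2 P) ∧
    Tendsto (fun n : ℕ => √(n : ℝ) * (n.choose 2 : ℝ)⁻¹ * ∫ ω, |pairSum h X n ω| ∂P) atTop
      (𝓝 0) := by
  have hm2 : Measurable fun q : ℝ × ℝ => h q.1 q.2 := hh.measurable
  have hS2 : ∀ n, MemLp (pairSum h X n) 2 P := fun n =>
    memLp_finsetSum _ fun j _ => memLp_finsetSum _ fun i _ =>
      .of_bound (hm2.comp ((hX i).prodMk (hX j))).aestronglyMeasurable B
        (.of_forall fun _ => hh.bound _ _)
  refine ⟨hS2, ?_⟩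
  have h1 := hh.tendsto_integral_pairSum_sq hassoc hX hstat hC hXC hcov
  have h2 : Tendsto (fun n : ℕ => 4 * √((∫ ω, pairSum h X n ω ^ 2 ∂P) / n ^ 3)) atTop (𝓝 0) := by
    simpa using ((Real.continuous_sqrt.tendsto 0).comp h1).const_mul 4
  refine squeeze_zero' (.of_forall fun n => ?_) ?_ h2
  · have : 0 ≤ ∫ ω, |pairSum h X n ω| ∂P := integral_nonneg fun _ => abs_nonneg _
    positivity
  · filter_upwards [eventually_ge_atTop 2] with n hn
    have hn2 : (2 : ℝ) ≤ n := by exact_mod_cast hn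
    have hn0 : (0 : ℝ) < n := by linarith
    have hint0 : 0 ≤ ∫ ω, |pairSum h X n ω| ∂P := integral_nonneg fun _ => abs_nonneg _
    have h3 : ∫ ω, |pairSum h X n ω| ∂P ≤ √(∫ ω, pairSum h X n ω ^ 2 ∂P) :=
      Real.le_sqrt_of_sq_le (sq_integral_abs_le (hS2 n))
    -- For `n ≥ 2` one has `n - 1 ≥ n / 2`.
    have hch : (n.choose 2 : ℝ)⁻¹ ≤ 4 / n ^ 2 := by
      rw [Nat.cast_choose_two, inv_le_comm₀ (by nlinarith) (by positivity), inv_div]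
      nlinarith
    have hs3 : √((n : ℝ) ^ 3) = n * √(n : ℝ) := by
      rw [show (n : ℝ) ^ 3 = n ^ 2 * n by ring, Real.sqrt_mul (by positivity),
        Real.sqrt_sq hn0.le]
    have hsq : √(n : ℝ) * √(n : ℝ) = n := Real.mul_self_sqrt hn0.le
    have hsp : 0 < √(n : ℝ) := Real.sqrt_pos.2 hn0
    calc √(n : ℝ) * (n.choose 2 : ℝ)⁻¹ * ∫ ω, |pairSum h X n ω| ∂P
        ≤ √(n : ℝ) * (4 / n ^ 2) * √(∫ ω, pairSum h X n ω ^ 2 ∂P) := by gcongr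
      _ = 4 * (√(∫ ω, pairSum h X n ω ^ 2 ∂P) / (n * √(n : ℝ))) := by
          have : (n : ℝ) ^ 2 = n * (√(n : ℝ) * √(n : ℝ)) := by rw [hsq]; ring
          rw [this]
          field_simp
      _ = 4 * √((∫ ω, pairSum h X n ω ^ 2 ∂P) / n ^ 3) := by
          rw [Real.sqrt_div' _ (by positivity), hs3]

end

end AssocUStat

end

/-! ### Assembly of the limit theorem. -/

theorem theorem3p4 {Ω : Type*} [MeasurableSpace Ω] (P : Measure Ω) [IsProbabilityMeasure P]
    -- the sequence; `X 0` is the first variable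
    (X : ℕ → Ω → ℝ) (hX : ∀ n, Measurable (X n))
    (hstat : AssocUStat.IsStrictlyStationary X P)
    (hassoc : AssocUStat.IsAssociated X P)
    (C₁ : ℝ) (hC₁ : 0 < C₁) (hbdd : ∀ n, ∀ᵐ ω ∂P, |X n ω| < C₁)
    (hcov : Summable fun j : ℕ => cov[X 0, X j; P] ^ (1 / 3 : ℝ))
    -- the symmetric kernel, for which `θ` and `ρ₁` are well defined
    (ρ : ℝ → ℝ → ℝ) (hρ : Measurable (Function.uncurry ρ)) (hsymm : ∀ x y, ρ x y = ρ y x)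
    (hint : Integrable (Function.uncurry ρ) ((P.map (X 0)).prod (P.map (X 0))))
    (hint₁ : ∀ x, Integrable (ρ x) (P.map (X 0)))
    -- `h⁽²⁾(x, y) h⁽²⁾(x', y')` has bounded second-order partial derivatives
    (hsmooth : AssocUStat.HasBoundedSecondPartials (Set.Icc (-C₁) C₁) (fun z : Fin 4 → ℝ =>
      AssocUStat.hTwo ρ (P.map (X 0)) (z 0) (z 1) * AssocUStat.hTwo ρ (P.map (X 0)) (z 2) (z 3)))
    -- `0 < Var ρ₁(X₁) < ∞`
    (hL2 : MemLp (fun ω => AssocUStat.rhoOne ρ (P.map (X 0)) (X 0 ω)) 2 P)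
    (hσ₁ : 0 < Var[fun ω => AssocUStat.rhoOne ρ (P.map (X 0)) (X 0 ω); P])
    (hσ₁j : Summable fun j : ℕ =>
      cov[fun ω => AssocUStat.rhoOne ρ (P.map (X 0)) (X 0 ω),
        fun ω => AssocUStat.rhoOne ρ (P.map (X 0)) (X (j + 1) ω); P])
    -- `ρ` is not monotonic in its first argument
    (hnonmono : ¬ (∀ y, Monotone fun x => ρ x y) ∧ ¬ (∀ y, Antitone fun x => ρ x y))
    (hσU : 0 < AssocUStat.sigmaSq (AssocUStat.rhoOne ρ (P.map (X 0))) X P)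
    (ρt : ℝ → ℝ) (hdom : AssocUStat.NewmanDominated (AssocUStat.rhoOne ρ (P.map (X 0))) ρt)
    (hcovt : Summable fun j : ℕ => cov[fun ω => ρt (X 0 ω), fun ω => ρt (X j ω); P]) :
    TendstoInDistribution
      (fun (n : ℕ) (ω : Ω) =>
        √(n : ℝ) * (AssocUStat.uStat ρ X n ω - AssocUStat.theta ρ (P.map (X 0))) /
          (2 * √(AssocUStat.sigmaSq (AssocUStat.rhoOne ρ (P.map (X 0))) X P)))
      atTop (id : ℝ → ℝ) (fun _ => P) (gaussianReal 0 1) := by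
  have hFprob : IsProbabilityMeasure (P.map (X 0)) :=
    Measure.isProbabilityMeasure_map (hX 0).aemeasurable
  have hXC : ∀ n, ∀ᵐ ω ∂P, |X n ω| ≤ C₁ := fun n => (hbdd n).mono fun ω h => h.le
  have hX2 : ∀ n, MemLp (X n) 2 P := fun n => .of_bound (hX n).aestronglyMeasurable C₁ (hXC n)
  have hcovs := AssocUStat.summable_cov_of_rpow
    (hassoc.cov_single_nonneg monotone_id hX2 0) hcov
  obtain ⟨B, L, M, hh⟩ := AssocUStat.exists_isSmoothDegenerate_hTwo_clip hX hC₁ hXC hρ hsymm hint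
    hint₁ hsmooth
  obtain ⟨hS2, hS⟩ := hh.tendsto_integral_abs hassoc hX hstat hC₁ hXC hcovs
  set F := P.map (X 0)
  set ρ₁ := AssocUStat.rhoOne ρ F with hρ₁
  set θ := AssocUStat.theta ρ F with hθ
  set σ2 := AssocUStat.sigmaSq ρ₁ X P with hσ2
  set h' : ℝ → ℝ → ℝ := fun x y =>
    AssocUStat.hTwo ρ F (AssocUStat.clip C₁ x) (AssocUStat.clip C₁ y) with hh'
  have hm1 : Measurable ρ₁ := AssocUStat.measurable_rhoOne hρ F
  set f : ℝ → ℝ := fun x => ρ₁ x - θ with hf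
  have hfm : Measurable f := hm1.sub_const _
  have hu : Monotone ρt := hdom.monotone
  have hfu : AssocUStat.Dom f ρt := hdom.dom.sub_const θ
  -- Monotonicity bounds `ρt` on the support, and domination passes boundedness on to `f`; all
  -- moments needed below follow.
  have huB : ∀ i, ∀ᵐ ω ∂P, ρt (X i ω) ∈ Set.Icc (ρt (-C₁)) (ρt C₁) := fun i => by
    filter_upwards [hXC i] with ω hω
    have := abs_le.1 hω
    exact ⟨hu this.1, hu this.2⟩
  have hu2 : ∀ i, MemLp (fun ω => ρt (X i ω)) 2 P := fun i =>
    memLp_of_bounded (huB i) (hu.measurable.comp (hX i)).aestronglyMeasurable 2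
  have hfB : ∀ i, ∀ᵐ ω ∂P, |f (X i ω)| ≤ |f (-C₁)| + (ρt C₁ - ρt (-C₁)) := fun i => by
    filter_upwards [hXC i, huB i] with ω hω hω2
    have h1 := hfu _ _ (abs_le.1 hω).1
    have h2 := abs_add_le (f (X i ω) - f (-C₁)) (f (-C₁))
    rw [sub_add_cancel] at h2
    linarith [hω2.2]
  have hf2 : ∀ i, MemLp (fun ω => f (X i ω)) 2 P := fun i =>
    .of_bound (hfm.comp (hX i)).aestronglyMeasurable _ (hfB i)
  have hρ2 : ∀ i, MemLp (fun ω => ρ₁ (X i ω)) 2 P := fun i => by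
    simpa [f, Pi.add_def] using (hf2 i).add (memLp_const θ)
  have hρi := fun i => (hρ2 i).integrable (q := 2) (by norm_num)
  have hσf : AssocUStat.sigmaSq f X P = σ2 := AssocUStat.sigmaSq_sub_const hρ2 θ
  have hfsum : Summable fun d =>
      cov[fun ω => f (X 0 ω), fun ω => f (X (d + 1) ω); P] := by
    refine hσ₁j.congr fun d => ?_
    simp only [hf]
    rw [covariance_sub_const_left (hρi 0), covariance_sub_const_right (hρi _)]
  have h0 : ∫ ω, f (X 0 ω) ∂P = 0 := by
    simp only [hf]
    rw [integral_sub (hρi 0) (integrable_const _)]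
    have : ∫ ω, ρ₁ (X 0 ω) ∂P = θ := by
      rw [hθ, ← AssocUStat.integral_rhoOne hint,
        integral_map (hX 0).aemeasurable hm1.aestronglyMeasurable]
    rw [this]
    simp
  set σ := √σ2 with hσ
  have hσpos : 0 < σ := Real.sqrt_pos.2 hσU
  have hclt := hassoc.tendsto_expI_sum hX hstat hfm hu hfu hu2 hcovt hfsum hfB h0
  rw [hσf] at hclt
  set Z : ℕ → Ω → ℝ := fun n ω => √(n : ℝ) * (AssocUStat.uStat ρ X n ω - θ) / (2 * σ) with hZ
  have hρm : Measurable fun q : ℝ × ℝ => ρ q.1 q.2 := hρ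
  have hUm : ∀ n, Measurable (AssocUStat.uStat ρ X n) := fun n => by
    refine Measurable.const_mul (Finset.measurable_fun_sum _ fun j _ =>
      Finset.measurable_fun_sum _ fun i _ => hρm.comp ((hX i).prodMk (hX j))) _
  have hZm : ∀ n, Measurable (Z n) := fun n => (((hUm n).sub_const _).const_mul _).div_const _
  refine ⟨fun n => (hZm n).aemeasurable, by fun_prop, ?_⟩
  refine ProbabilityMeasure.tendsto_iff_tendsto_charFun.2 fun t => ?_
  simp only [ProbabilityMeasure.coe_mk, Measure.map_id, charFun_gaussianReal]
  have hchar : ∀ n, charFun (P.map (Z n)) t = AssocUStat.expI P (fun ω => t * Z n ω) := fun n => by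
    rw [charFun_apply_real, integral_map (hZm n).aemeasurable (by fun_prop)]
    simp [AssocUStat.expI]
  simp only [hchar]
  -- The linear part of `t * Z n`: the 2 of the Hoeffding decomposition cancels the 2 in `2 * σ`, so
  -- the central limit theorem is used at `t / σ`.
  set W : ℕ → Ω → ℝ := fun n ω => t / σ / √(n : ℝ) * ∑ i ∈ Finset.range n, f (X i ω) with hW
  have hWm : ∀ n, Measurable (W n) := fun n => by fun_prop
  have hWlim : Tendsto (fun n => AssocUStat.expI P (W n)) atTop
      (𝓝 (Complex.exp (t * (0 : ℝ) * Complex.I - ((1 : NNReal) : ℝ) * t ^ 2 / 2))) := by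
    convert! hclt (t / σ) using 2
    rw [div_pow, hσ, Real.sq_sqrt hσU.le]
    have : σ2 * (t ^ 2 / σ2) = t ^ 2 := by field_simp
    rw [this]
    congr 1
    push_cast
    ring
  have hdiff : Tendsto (fun n => AssocUStat.expI P (fun ω => t * Z n ω) -
      AssocUStat.expI P (W n)) atTop (𝓝 0) := by
    have hlim : Tendsto (fun n : ℕ => |t| / (2 * σ) *
        (√(n : ℝ) * (n.choose 2 : ℝ)⁻¹ * ∫ ω, |AssocUStat.pairSum h' X n ω| ∂P)) atTop (𝓝 0) := by
      simpa using hS.const_mul (|t| / (2 * σ))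
    refine squeeze_zero_norm' ?_ hlim
    filter_upwards [eventually_ge_atTop 2] with n hn
    have hn0 : (0 : ℝ) < n := by positivity
    set κ := √(n : ℝ) * (n.choose 2 : ℝ)⁻¹ with hκ
    have hκ0 : 0 ≤ κ := by positivity
    -- Almost surely clipping acts trivially on the sample, so the remainder may be written with the
    -- globally smooth kernel `h'`.
    have hae : ∀ᵐ ω ∂P, t * Z n ω - W n ω =
        t / (2 * σ) * κ * AssocUStat.pairSum h' X n ω := by
      filter_upwards [ae_all_iff.2 hXC] with ω hω
      have hpair : AssocUStat.pairSum h' X n ω =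
          AssocUStat.pairSum (AssocUStat.hTwo ρ F) X n ω := by
        simp only [AssocUStat.pairSum, hh', AssocUStat.clip_of_abs_le (hω _)]
      rw [hpair]
      simp only [hZ, hW, hκ]
      rw [AssocUStat.uStat_sub_theta ρ F X hn ω]
      have hsp : 0 < √(n : ℝ) := Real.sqrt_pos.2 hn0
      have hsq : (n : ℝ) = √(n : ℝ) * √(n : ℝ) := (Real.mul_self_sqrt hn0.le).symm
      have e : √(n : ℝ) * (2 / n) = 2 / √(n : ℝ) := by
        nth_rewrite 2 [hsq]
        field_simp
      rw [mul_add, ← mul_assoc, e]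
      simp only [hf, hρ₁, hθ]
      field_simp
      ring
    have hi : Integrable (fun ω => t / (2 * σ) * κ * AssocUStat.pairSum h' X n ω) P :=
      ((hS2 n).integrable (by norm_num)).const_mul _
    have hi' : Integrable (fun ω => t * Z n ω - W n ω) P :=
      hi.congr (hae.mono fun ω h => h.symm)
    refine (AssocUStat.norm_expI_sub_le ((hZm n).const_mul t) (hWm n) hi').trans (le_of_eq ?_)
    rw [← integral_const_mul, ← integral_const_mul]
    refine integral_congr_ae ?_
    filter_upwards [hae] with ω hω
    rw [hω, abs_mul, abs_mul, abs_div, abs_of_pos (by positivity : 0 < 2 * σ), abs_of_nonneg hκ0]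
    ring
  simpa using hdiff.add hWlim
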